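/- All graphs are finite and simple. A (vertex-)colored graph is a graph $X$ together with an arbitrary map $c : V(X) \to C$ to a set of colors (adjacent vertices may have the same color). A magic unitary over a unital $C^*$-algebra is a matrix of projections each of whose rows and columns sums to $1$. The quantum automorphism group $\mathrm{Qut}_c(X)$ is the compact matrix quantum group $(C(\mathrm{Qut}_c(X)), u)$, where $C(\mathrm{Qut}_c(X))$ is the universal unital $C^*$-algebra with generators $u_{ij}$ $(i,j \in V(X))$ subject to the relations that $u = (u_{ij})$ is a magic unitary, $u_{ij}u_{kl} = 0$ whenever exactly one of $ik$, $jl$ is an edge of $X$, and $u_{ij} = 0$ whenever $c(i) \neq c(j)$; its comultiplication is $\Delta(u_{ij}) = \sum_k u_{ik} \otimes u_{kj}$. Colored graphs $X$ and $Y$ are quantum isomorphic if there are a nonzero unital $C^*$-algebra $\mathcal A$ and a magic unitary $u = (u_{xy})_{x \in V(X), y \in V(Y)}$ over $\mathcal A$ such that $A_X u = u A_Y$ (with $A_X, A_Y$ the adjacency matrices) and $u_{xy} = 0$ whenever $c(x) \neq c(y)$. The free product $\ast_i \mathbb G_i$ of compact matrix quantum groups $\mathbb G_i = (C(\mathbb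 G_i), u^{(i)})$ is given by the unital free product (with identified units) of the $C^*$-algebras $C(\mathbb G_i)$ with fundamental representation the block-diagonal matrix $\bigoplus_i u^{(i)}$. Lemma. Let $X_1, \dots, X_n$ be vertex-colored graphs (with colors in a common set) such that for all $i \neq j$ no connected component of $X_i$ is quantum isomorphic to a connected component of $X_j$. Then $$\mathrm{Qut}_c\Big(\bigsqcup_{i=1}^n X_i\Big) = \mathop{\ast}_{i=1}^n \mathrm{Qut}_c(X_i)$$ as compact matrix quantum groups: there is a $*$-isomorphism between the two $C^*$-algebras that maps the fundamental representation of $\mathrm{Qut}_c(\bigsqcup_i X_i)$ entrywise to $\bigoplus_i u^{(i)}$, where $u^{(i)}$ is the fundamental representation of $\mathrm{Qut}_c(X_i)$, and that intertwines the comultiplications. -/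

import Mathlib

open scoped TensorProduct

universe u

/-! ### Completions of complex star-algebras with respect to C*-seminorms -/

/-- A C*-seminorm on a unital complex *-algebra: a submultiplicative seminorm satisfying the
C*-identity `p (a* a) = p a ^ 2`. -/
structure CStarSeminorm (A : Type*) [Ring A] [StarRing A] [Algebra ℂ A] extends
    Seminorm ℂ A where
  mul_le' : ∀ a b, toFun (a * b) ≤ toFun a * toFun b
  star_mul_self' : ∀ a, toFun (star a * a) = toFun a ^ 2

namespace CStarSeminorm

section Basic

variable {A : Type*} [Ring A] [StarRing A] [Algebra ℂ A]

noncomputable instance : CoeFun (CStarSeminorm A) (fun _ => A → ℝ) := ⟨fun p => p.toSeminorm⟩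

theorem mul_le (p : CStarSeminorm A) (a b : A) : p (a * b) ≤ p a * p b := p.mul_le' a b

theorem star_mul_self (p : CStarSeminorm A) (a : A) : p (star a * a) = p a ^ 2 :=
  p.star_mul_self' a

theorem nonneg (p : CStarSeminorm A) (a : A) : 0 ≤ p a := apply_nonneg p.toSeminorm a

theorem le_star (p : CStarSeminorm A) (a : A) : p a ≤ p (star a) := by
  rcases (p.nonneg a).eq_or_lt with h | h
  · rw [← h]; exact p.nonneg _
  · have h1 := p.star_mul_self a
    have h2 := p.mul_le (star a) a
    rw [h1, sq] at h2
    exact le_of_mul_le_mul_right h2 h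

theorem star_eq (p : CStarSeminorm A) (a : A) : p (star a) = p a :=
  le_antisymm (by simpa using p.le_star (star a)) (p.le_star a)

/-- A copy of `A`, carrying the seminorm `p`. -/
def Alg (_ : CStarSeminorm A) : Type _ := A

variable (p : CStarSeminorm A)

instance : Ring p.Alg := inferInstanceAs (Ring A)
instance : StarRing p.Alg := inferInstanceAs (StarRing A)
instance : Algebra ℂ p.Alg := inferInstanceAs (Algebra ℂ A)
instance [StarModule ℂ A] : StarModule ℂ p.Alg := inferInstanceAs (StarModule ℂ A)

/-- The identity map `A → p.Alg`. -/
noncomputable def toAlg : A →⋆ₐ[ℂ] p.Alg := StarAlgHom.id ℂ A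

noncomputable instance : SeminormedRing p.Alg :=
  { (inferInstance : Ring p.Alg), p.toAddGroupSeminorm.toSeminormedAddCommGroup with
    norm_mul_le := p.mul_le' }

theorem norm_toAlg (a : A) : ‖p.toAlg a‖ = p a := rfl

noncomputable instance : NormedAlgebra ℂ p.Alg where
  norm_smul_le c a := (map_smul_eq_mul p.toSeminorm c a).le

theorem norm_star_alg (a : p.Alg) : ‖star a‖ = ‖a‖ := p.star_eq a

theorem norm_star_mul_self_alg (a : p.Alg) : ‖star a * a‖ = ‖a‖ ^ 2 := p.star_mul_self a

/-- The C*-algebra obtained from `A` by dividing out the null space of `p` and completing. -/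
def Completion : Type _ := UniformSpace.Completion p.Alg

noncomputable instance : NormedRing p.Completion :=
  inferInstanceAs (NormedRing (UniformSpace.Completion p.Alg))

noncomputable instance : Algebra ℂ p.Completion :=
  inferInstanceAs (Algebra ℂ (UniformSpace.Completion p.Alg))

instance : CompleteSpace p.Completion :=
  inferInstanceAs (CompleteSpace (UniformSpace.Completion p.Alg))

noncomputable instance : NormedAlgebra ℂ p.Completion where
  norm_smul_le c a := norm_smul_le (β := UniformSpace.Completion p.Alg) c a

/-- The canonical ring homomorphism with dense range into the completion. -/
noncomputable def coeRingHom : A →+* p.Completion :=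
  (UniformSpace.Completion.coeRingHom : p.Alg →+* UniformSpace.Completion p.Alg)

theorem norm_coe (a : A) : ‖p.coeRingHom a‖ = p a :=
  UniformSpace.Completion.norm_coe (p.toAlg a)

theorem denseRange_coe : DenseRange p.coeRingHom :=
  UniformSpace.Completion.denseRange_coe (α := p.Alg)

theorem uniformContinuous_star_alg : UniformContinuous (star : p.Alg → p.Alg) := by
  have : Isometry (starAddEquiv : p.Alg ≃+ p.Alg) :=
    AddMonoidHomClass.isometry_of_norm _ (fun a => p.norm_star_alg a)
  exact this.uniformContinuous

noncomputable instance : Star p.Completion :=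
  ⟨UniformSpace.Completion.map (star : p.Alg → p.Alg)⟩

theorem coe_star (a : A) : p.coeRingHom (star a) = star (p.coeRingHom a) :=
  (UniformSpace.Completion.map_coe p.uniformContinuous_star_alg (p.toAlg a)).symm

theorem continuous_star_completion : Continuous (star : p.Completion → p.Completion) :=
  UniformSpace.Completion.continuous_map

variable {p} in
theorem completion_induction {P : p.Completion → Prop} (a : p.Completion)
    (hP : IsClosed {a | P a}) (h : ∀ a : A, P (p.coeRingHom a)) : P a :=
  p.denseRange_coe.induction_on a hP h

noncomputable instance : StarRing p.Completion where
  star_involutive a := by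
    induction a using completion_induction with
    | hP => exact isClosed_eq
              (p.continuous_star_completion.comp p.continuous_star_completion) continuous_id
    | h a => rw [← coe_star, ← coe_star, star_star]
  star_mul a b := by
    have hs := p.continuous_star_completion
    induction a using completion_induction with
    | hP => exact isClosed_eq (hs.comp (by fun_prop)) (by fun_prop)
    | h a =>
      induction b using completion_induction with
      | hP => exact isClosed_eq (hs.comp (by fun_prop)) (by fun_prop)
      | h b => rw [← map_mul, ← coe_star, ← coe_star, ← coe_star, star_mul, map_mul]
  star_add a b := by
    have hs := p.continuous_star_completion
    induction a using completion_induction with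
    | hP => exact isClosed_eq (hs.comp (by fun_prop)) (by fun_prop)
    | h a =>
      induction b using completion_induction with
      | hP => exact isClosed_eq (hs.comp (by fun_prop)) (by fun_prop)
      | h b => rw [← map_add, ← coe_star, ← coe_star, ← coe_star, star_add, map_add]

theorem coe_algebraMap (c : ℂ) : p.coeRingHom (algebraMap ℂ A c) = algebraMap ℂ p.Completion c :=
  rfl

theorem coe_smul (c : ℂ) (a : A) : p.coeRingHom (c • a) = c • p.coeRingHom a := by
  rw [Algebra.smul_def, map_mul, coe_algebraMap, ← Algebra.smul_def]

/-- The canonical *-homomorphism with dense range into the completion. -/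
noncomputable def coe : A →⋆ₐ[ℂ] p.Completion where
  __ := p.coeRingHom
  commutes' := p.coe_algebraMap
  map_star' := p.coe_star

theorem coe_denseRange : DenseRange p.coe := p.denseRange_coe

theorem norm_coe_apply (a : A) : ‖p.coe a‖ = p a := p.norm_coe a

theorem induction_on {P : p.Completion → Prop} (a : p.Completion)
    (hP : IsClosed {a | P a}) (h : ∀ a : A, P (p.coe a)) : P a :=
  p.coe_denseRange.induction_on a hP h

/-- A *-homomorphism into a C*-algebra whose norm is dominated by `p` extends to the completion. -/
noncomputable def lift {B : Type*} [CStarAlgebra B] (f : A →⋆ₐ[ℂ] B) (hf : ∀ a, ‖f a‖ ≤ p a) :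
    p.Completion →⋆ₐ[ℂ] B :=
  let g : p.Alg →+* B := (f : A →+* B)
  have hg : Continuous g :=
    (AddMonoidHomClass.lipschitz_of_bound g 1 (fun a => by simpa using! hf a)).continuous
  have key : ∀ a : A, UniformSpace.Completion.extensionHom g hg (p.coeRingHom a) = f a :=
    fun a => UniformSpace.Completion.extensionHom_coe g hg (p.toAlg a)
  have hc : Continuous (fun a : p.Completion => UniformSpace.Completion.extensionHom g hg a) :=
    UniformSpace.Completion.continuous_extension
  { toFun := fun a : p.Completion => UniformSpace.Completion.extensionHom g hg a
    map_zero' := map_zero (UniformSpace.Completion.extensionHom g hg)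
    map_one' := map_one (UniformSpace.Completion.extensionHom g hg)
    map_add' := map_add (UniformSpace.Completion.extensionHom g hg)
    map_mul' := map_mul (UniformSpace.Completion.extensionHom g hg)
    commutes' := fun c => by
      rw [← coe_algebraMap, key, AlgHomClass.commutes]
    map_star' := fun a => by
      have hs := p.continuous_star_completion
      induction a using completion_induction with
      | hP => exact isClosed_eq (hc.comp hs) (continuous_star.comp hc)
      | h a => rw [← coe_star, key, key, map_star] }

theorem lift_coe {B : Type*} [CStarAlgebra B] (f : A →⋆ₐ[ℂ] B) (hf : ∀ a, ‖f a‖ ≤ p a) (a : A) :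
    p.lift f hf (p.coe a) = f a := by
  let g : p.Alg →+* B := (f : A →+* B)
  have hg : Continuous g :=
    (AddMonoidHomClass.lipschitz_of_bound g 1 (fun a => by simpa using! hf a)).continuous
  exact UniformSpace.Completion.extensionHom_coe g hg (p.toAlg a)

/-- The C*-seminorm `a ↦ ‖f a‖` defined by a *-homomorphism into a C*-algebra. -/
noncomputable def ofHom {B : Type*} [CStarAlgebra B] (f : A →⋆ₐ[ℂ] B) : CStarSeminorm A where
  toSeminorm := (normSeminorm ℂ B).comp (f : A →ₐ[ℂ] B).toLinearMap
  mul_le' a b := by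
    change ‖f (a * b)‖ ≤ ‖f a‖ * ‖f b‖
    rw [map_mul]
    exact norm_mul_le _ _
  star_mul_self' a := by
    change ‖f (star a * a)‖ = ‖f a‖ ^ 2
    rw [map_mul, map_star, CStarRing.norm_star_mul_self, sq]

theorem ofHom_apply {B : Type*} [CStarAlgebra B] (f : A →⋆ₐ[ℂ] B) (a : A) :
    ofHom f a = ‖f a‖ := rfl

variable [StarModule ℂ A]

instance : StarModule ℂ p.Completion where
  star_smul c a := by
    have hs := p.continuous_star_completion
    induction a using completion_induction with
    | hP => exact isClosed_eq (hs.comp (continuous_const_smul c)) (hs.const_smul (star c))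
    | h a => rw [← coe_smul, ← coe_star, star_smul, coe_smul, coe_star]

noncomputable instance : CStarAlgebra p.Completion where
  norm_mul_self_le a := by
    have hs := p.continuous_star_completion
    induction a using completion_induction with
    | hP => exact isClosed_le (by fun_prop) (by fun_prop)
    | h a => rw [← coe_star, ← map_mul, norm_coe, norm_coe, star_mul_self, sq]

end Basic

section Sup

variable {A : Type*} [Ring A] [StarRing A] [Algebra ℂ A]

open scoped Pointwise in
/-- The pointwise supremum of a pointwise bounded set of C*-seminorms. -/
noncomputable def sup (P : Set (CStarSeminorm A)) (hP : ∀ a, BddAbove ((fun p => p a) '' P)) :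
    CStarSeminorm A where
  toFun a := sSup ((fun p : CStarSeminorm A => p a) '' P)
  map_zero' := by
    apply le_antisymm
    · apply Real.sSup_le _ le_rfl
      rintro _ ⟨p, -, rfl⟩
      exact (map_zero p.toSeminorm).le
    · apply Real.sSup_nonneg
      rintro _ ⟨p, -, rfl⟩
      exact p.nonneg _
  add_le' a b := by
    have h0 : ∀ a : A, 0 ≤ sSup ((fun p : CStarSeminorm A => p a) '' P) := fun a =>
      Real.sSup_nonneg (by rintro _ ⟨p, -, rfl⟩; exact p.nonneg _)
    apply Real.sSup_le _ (add_nonneg (h0 a) (h0 b))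
    rintro _ ⟨p, hp, rfl⟩
    exact (map_add_le_add p.toSeminorm a b).trans
      (add_le_add (le_csSup (hP a) ⟨p, hp, rfl⟩) (le_csSup (hP b) ⟨p, hp, rfl⟩))
  neg' a := by
    congr 1
    apply Set.image_congr
    intro p _
    exact map_neg_eq_map p.toSeminorm a
  smul' c a := by
    have : (fun p : CStarSeminorm A => p (c • a)) '' P =
        ‖c‖ • ((fun p : CStarSeminorm A => p a) '' P) := by
      rw [← Set.image_smul, Set.image_image]
      exact Set.image_congr (fun p _ => map_smul_eq_mul p.toSeminorm c a)
    rw [this, Real.sSup_smul_of_nonneg (norm_nonneg c), smul_eq_mul]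
  mul_le' a b := by
    have h0 : ∀ a : A, 0 ≤ sSup ((fun p : CStarSeminorm A => p a) '' P) := fun a =>
      Real.sSup_nonneg (by rintro _ ⟨p, -, rfl⟩; exact p.nonneg _)
    apply Real.sSup_le _ (mul_nonneg (h0 a) (h0 b))
    rintro _ ⟨p, hp, rfl⟩
    exact (p.mul_le a b).trans (mul_le_mul (le_csSup (hP a) ⟨p, hp, rfl⟩)
      (le_csSup (hP b) ⟨p, hp, rfl⟩) (p.nonneg _) (h0 a))
  star_mul_self' a := by
    have h0 : ∀ a : A, 0 ≤ sSup ((fun p : CStarSeminorm A => p a) '' P) := fun a =>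
      Real.sSup_nonneg (by rintro _ ⟨p, -, rfl⟩; exact p.nonneg _)
    apply le_antisymm
    · apply Real.sSup_le _ (sq_nonneg _)
      rintro _ ⟨p, hp, rfl⟩
      change p (star a * a) ≤ _
      rw [p.star_mul_self]
      exact pow_le_pow_left₀ (p.nonneg _) (le_csSup (hP a) ⟨p, hp, rfl⟩) 2
    · rw [← Real.le_sqrt (h0 a) (h0 _)]
      apply Real.sSup_le _ (Real.sqrt_nonneg _)
      rintro _ ⟨p, hp, rfl⟩
      apply Real.le_sqrt_of_sq_le
      change p a ^ 2 ≤ _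
      rw [← p.star_mul_self]
      exact le_csSup (hP _) ⟨p, hp, rfl⟩

theorem sup_apply (P : Set (CStarSeminorm A)) (hP : ∀ a, BddAbove ((fun p => p a) '' P)) (a : A) :
    sup P hP a = sSup ((fun p : CStarSeminorm A => p a) '' P) := rfl

theorem le_sup (P : Set (CStarSeminorm A)) (hP : ∀ a, BddAbove ((fun p => p a) '' P))
    {p : CStarSeminorm A} (hp : p ∈ P) (a : A) : p a ≤ sup P hP a :=
  le_csSup (hP a) ⟨p, hp, rfl⟩

theorem sup_le (P : Set (CStarSeminorm A)) (hP : ∀ a, BddAbove ((fun p => p a) '' P))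
    {a : A} {r : ℝ} (hr : 0 ≤ r) (h : ∀ p ∈ P, p a ≤ r) : sup P hP a ≤ r :=
  Real.sSup_le (by rintro _ ⟨p, hp, rfl⟩; exact h p hp) hr

end Sup

end CStarSeminorm

/-! ### The free *-algebra on a set, and universal C*-algebras -/

/-- The free unital complex *-algebra on the set `S`: the free algebra on the generators
`s` (`Sum.inl s`) and their adjoints `s*` (`Sum.inr s`). -/
def FreeStarAlgebra (S : Type u) : Type u := FreeAlgebra ℂ (S ⊕ S)

namespace FreeStarAlgebra

variable {S : Type u}

noncomputable instance : Ring (FreeStarAlgebra S) := inferInstanceAs (Ring (FreeAlgebra ℂ (S ⊕ S)))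
noncomputable instance : Algebra ℂ (FreeStarAlgebra S) :=
  inferInstanceAs (Algebra ℂ (FreeAlgebra ℂ (S ⊕ S)))

/-- The generators and their adjoints. -/
noncomputable def gen (x : S ⊕ S) : FreeStarAlgebra S := FreeAlgebra.ι ℂ x

/-- The generator attached to `s`. -/
noncomputable def of (s : S) : FreeStarAlgebra S := gen (Sum.inl s)

/-- Induction on the construction of elements of the free *-algebra. -/
theorem induction {P : FreeStarAlgebra S → Prop} (hc : ∀ c : ℂ, P (algebraMap ℂ _ c))
    (hg : ∀ x, P (gen x)) (hm : ∀ a b, P a → P b → P (a * b)) (ha : ∀ a b, P a → P b → P (a + b))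
    (a : FreeStarAlgebra S) : P a :=
  FreeAlgebra.induction ℂ (S ⊕ S) (motive := P) hc hg hm ha a

/-- The opposite of the free *-algebra with the conjugate action of `ℂ`. -/
def ConjOp (S : Type u) : Type u := (FreeStarAlgebra S)ᵐᵒᵖ

noncomputable instance : Ring (ConjOp S) := inferInstanceAs (Ring (FreeStarAlgebra S)ᵐᵒᵖ)
noncomputable instance : Algebra ℂ (ConjOp S) :=
  Algebra.compHom (FreeStarAlgebra S)ᵐᵒᵖ (starRingEnd ℂ)

/-- The involution, as a homomorphism into the opposite conjugate algebra. It exchanges the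
generators `s` and `s*`. -/
noncomputable def starHom : FreeStarAlgebra S →ₐ[ℂ] ConjOp S :=
  FreeAlgebra.lift ℂ (fun x : S ⊕ S => (MulOpposite.op (gen x.swap) : (FreeStarAlgebra S)ᵐᵒᵖ))

noncomputable instance : Star (FreeStarAlgebra S) :=
  ⟨fun a => MulOpposite.unop (starHom a : (FreeStarAlgebra S)ᵐᵒᵖ)⟩

theorem star_gen (x : S ⊕ S) : star (gen x : FreeStarAlgebra S) = gen x.swap :=
  congrArg MulOpposite.unop (FreeAlgebra.lift_ι_apply (R := ℂ) (A := ConjOp S)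
    (fun x : S ⊕ S => (MulOpposite.op (gen x.swap) : (FreeStarAlgebra S)ᵐᵒᵖ)) x)

theorem star_algebraMap (c : ℂ) : star (algebraMap ℂ (FreeStarAlgebra S) c) =
    algebraMap ℂ (FreeStarAlgebra S) (star c) :=
  congrArg MulOpposite.unop ((starHom (S := S)).commutes c)

theorem star_mul_free (a b : FreeStarAlgebra S) : star (a * b) = star b * star a :=
  congrArg MulOpposite.unop (map_mul (starHom (S := S)) a b)

theorem star_add_free (a b : FreeStarAlgebra S) : star (a + b) = star a + star b :=
  congrArg MulOpposite.unop (map_add (starHom (S := S)) a b)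

noncomputable instance : StarRing (FreeStarAlgebra S) where
  star_involutive a := by
    induction a using induction with
    | hc c => rw [star_algebraMap, star_algebraMap, star_star]
    | hg x => rw [star_gen, star_gen, Sum.swap_swap]
    | hm a b ha hb => rw [star_mul_free, star_mul_free, ha, hb]
    | ha a b ha hb => rw [star_add_free, star_add_free, ha, hb]
  star_mul := star_mul_free
  star_add := star_add_free

instance : StarModule ℂ (FreeStarAlgebra S) where
  star_smul c a := by
    rw [Algebra.smul_def, Algebra.smul_def, star_mul, star_algebraMap]
    exact (Algebra.commutes _ _).symm

/-- The universal property of the free *-algebra. -/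
noncomputable def lift {B : Type*} [Ring B] [StarRing B] [Algebra ℂ B] [StarModule ℂ B]
    (f : S → B) : FreeStarAlgebra S →⋆ₐ[ℂ] B :=
  let g : FreeStarAlgebra S →ₐ[ℂ] B :=
    FreeAlgebra.lift ℂ (Sum.elim f (fun s => star (f s)))
  have hgen : ∀ x, g (gen x) = Sum.elim f (fun s => star (f s)) x := fun x =>
    FreeAlgebra.lift_ι_apply _ x
  { g with
    map_star' := fun a => by
      change g (star a) = star (g a)
      induction a using induction with
      | hc c => rw [star_algebraMap, g.commutes, g.commutes, algebraMap_star_comm]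
      | hg x => cases x <;> simp [star_gen, hgen]
      | hm a b ha hb => rw [star_mul, map_mul, map_mul, star_mul, ha, hb]
      | ha a b ha hb => rw [star_add, map_add, map_add, star_add, ha, hb] }

theorem lift_of {B : Type*} [Ring B] [StarRing B] [Algebra ℂ B] [StarModule ℂ B]
    (f : S → B) (s : S) : lift f (of s) = f s :=
  FreeAlgebra.lift_ι_apply (R := ℂ) (Sum.elim f (fun s => star (f s))) (Sum.inl s)

end FreeStarAlgebra

namespace UniversalCStar

variable {S : Type u}

/-- The C*-seminorms on the free *-algebra that vanish on a set `R` of relations. -/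
def admissible (R : Set (FreeStarAlgebra S)) : Set (CStarSeminorm (FreeStarAlgebra S)) :=
  {p | ∀ r ∈ R, p r = 0}

/-- The relations `R` bound the generators. This is the standard condition
for the universal C*-algebra with generators `S` and relations `R` to exist. -/
def IsBounded (R : Set (FreeStarAlgebra S)) : Prop :=
  ∀ s : S, BddAbove ((fun p => p (FreeStarAlgebra.of s)) '' admissible R)

theorem IsBounded.bddAbove {R : Set (FreeStarAlgebra S)} (hR : IsBounded R)
    (a : FreeStarAlgebra S) : BddAbove ((fun p => p a) '' admissible R) := by
  have one_le : ∀ p : CStarSeminorm (FreeStarAlgebra S), p 1 ≤ 1 := by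
    intro p
    have h := p.star_mul_self 1
    rw [star_one, one_mul] at h
    nlinarith [p.nonneg 1, sq_nonneg (p 1 - 1)]
  induction a using FreeStarAlgebra.induction with
  | hc c =>
    refine ⟨‖c‖, ?_⟩
    rintro _ ⟨p, -, rfl⟩
    change p _ ≤ _
    rw [Algebra.algebraMap_eq_smul_one, map_smul_eq_mul]
    exact mul_le_of_le_one_right (norm_nonneg c) (one_le p)
  | hg x =>
    cases x with
    | inl s => exact hR s
    | inr s =>
      obtain ⟨M, hM⟩ := hR s
      refine ⟨M, ?_⟩
      rintro _ ⟨p, hp, rfl⟩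
      have h1 : star (FreeStarAlgebra.of s) = FreeStarAlgebra.gen (Sum.inr s) :=
        FreeStarAlgebra.star_gen _
      change p _ ≤ _
      rw [← h1, p.star_eq]
      exact hM ⟨p, hp, rfl⟩
  | hm a b ha hb =>
    obtain ⟨M, hM⟩ := ha
    obtain ⟨N, hN⟩ := hb
    refine ⟨M * N, ?_⟩
    rintro _ ⟨p, hp, rfl⟩
    have h1 : p a ≤ M := hM ⟨p, hp, rfl⟩
    have h2 : p b ≤ N := hN ⟨p, hp, rfl⟩
    exact (p.mul_le a b).trans
      (mul_le_mul h1 h2 (p.nonneg b) ((p.nonneg a).trans h1))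
  | ha a b ha hb =>
    obtain ⟨M, hM⟩ := ha
    obtain ⟨N, hN⟩ := hb
    refine ⟨M + N, ?_⟩
    rintro _ ⟨p, hp, rfl⟩
    have h1 : p a ≤ M := hM ⟨p, hp, rfl⟩
    have h2 : p b ≤ N := hN ⟨p, hp, rfl⟩
    exact (map_add_le_add p.toSeminorm a b).trans (add_le_add h1 h2)

/-- The largest C*-seminorm on the free *-algebra that vanishes on the relations. -/
noncomputable def seminorm (R : Set (FreeStarAlgebra S)) (hR : IsBounded R) :
    CStarSeminorm (FreeStarAlgebra S) :=
  CStarSeminorm.sup (admissible R) hR.bddAbove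

end UniversalCStar

/-- The universal (unital) C*-algebra with generators `S` and relations `r = 0`, `r ∈ R`. -/
abbrev UniversalCStar {S : Type u} (R : Set (FreeStarAlgebra S))
    (hR : UniversalCStar.IsBounded R) : Type u :=
  (UniversalCStar.seminorm R hR).Completion

namespace UniversalCStar

variable {S : Type u} (R : Set (FreeStarAlgebra S)) (hR : IsBounded R)

/-- The canonical map of the free *-algebra into the universal C*-algebra. -/
noncomputable def mk : FreeStarAlgebra S →⋆ₐ[ℂ] UniversalCStar R hR := (seminorm R hR).coe

/-- The generators of the universal C*-algebra. -/
noncomputable def gen (s : S) : UniversalCStar R hR := mk R hR (FreeStarAlgebra.of s)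

theorem mk_eq_zero {r : FreeStarAlgebra S} (hr : r ∈ R) : mk R hR r = 0 := by
  rw [← norm_eq_zero, mk, CStarSeminorm.norm_coe_apply]
  exact le_antisymm (CStarSeminorm.sup_le _ _ le_rfl (fun p hp => (hp r hr).le))
    (CStarSeminorm.nonneg _ _)

/-- Elements of a C*-algebra satisfying the relations define a *-homomorphism on the universal
C*-algebra. -/
noncomputable def lift {B : Type*} [CStarAlgebra B] (f : S → B)
    (hf : ∀ r ∈ R, FreeStarAlgebra.lift f r = 0) : UniversalCStar R hR →⋆ₐ[ℂ] B :=
  (seminorm R hR).lift (FreeStarAlgebra.lift f) (fun a =>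
    CStarSeminorm.le_sup (admissible R) hR.bddAbove
      (p := CStarSeminorm.ofHom (FreeStarAlgebra.lift f))
      (fun r hr => by rw [CStarSeminorm.ofHom_apply, hf r hr, norm_zero]) a)

theorem lift_mk {B : Type*} [CStarAlgebra B] (f : S → B)
    (hf : ∀ r ∈ R, FreeStarAlgebra.lift f r = 0) (a : FreeStarAlgebra S) :
    lift R hR f hf (mk R hR a) = FreeStarAlgebra.lift f a :=
  CStarSeminorm.lift_coe _ _ _ _

theorem lift_gen {B : Type*} [CStarAlgebra B] (f : S → B)
    (hf : ∀ r ∈ R, FreeStarAlgebra.lift f r = 0) (s : S) :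
    lift R hR f hf (gen R hR s) = f s := by
  rw [gen, lift_mk, FreeStarAlgebra.lift_of]

/-- The generators generate the universal C*-algebra topologically. -/
theorem topologicalClosure_adjoin_gen :
    (StarAlgebra.adjoin ℂ (Set.range (gen R hR))).topologicalClosure = ⊤ := by
  rw [eq_top_iff]
  rintro a -
  have h : ∀ a, mk R hR a ∈ StarAlgebra.adjoin ℂ (Set.range (gen R hR)) := by
    intro a
    induction a using FreeStarAlgebra.induction with
    | hc c => rw [AlgHomClass.commutes]; exact algebraMap_mem _ c
    | hg x =>
      cases x with
      | inl s => exact StarAlgebra.subset_adjoin ℂ _ ⟨s, rfl⟩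
      | inr s =>
        have h1 : star (FreeStarAlgebra.of s) = FreeStarAlgebra.gen (Sum.inr s) :=
          FreeStarAlgebra.star_gen _
        rw [← h1, map_star]
        exact star_mem (StarAlgebra.subset_adjoin ℂ _ ⟨s, rfl⟩)
    | hm a b ha hb => rw [map_mul]; exact mul_mem ha hb
    | ha a b ha hb => rw [map_add]; exact add_mem ha hb
  exact (seminorm R hR).induction_on a isClosed_closure (fun a => subset_closure (h a))

end UniversalCStar

/-! ### The minimal (spatial) tensor product of C*-algebras -/

namespace MinTensor

variable {A B : Type u} [CStarAlgebra A] [CStarAlgebra B]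

section Rep

variable {H K : Type u} [NormedAddCommGroup H] [InnerProductSpace ℂ H] [CompleteSpace H]
  [NormedAddCommGroup K] [InnerProductSpace ℂ K] [CompleteSpace K]

theorem norm_inner_self {E : Type*} [NormedAddCommGroup E] [InnerProductSpace ℂ E] (v : E) :
    ‖(inner ℂ v v : ℂ)‖ = ‖v‖ ^ 2 := by
  rw [inner_self_eq_norm_sq_to_K]
  simp

/-- The representation `π ⊗ ρ` of the algebraic tensor product on the (pre-)Hilbert space `H ⊗ K`,
`(π ⊗ ρ) (a ⊗ b) = π a ⊗ ρ b`, for representations `π` on `H` and `ρ` on `K`. -/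
noncomputable def rep (π : A →⋆ₐ[ℂ] (H →L[ℂ] H)) (ρ : B →⋆ₐ[ℂ] (K →L[ℂ] K)) :
    A ⊗[ℂ] B →ₐ[ℂ] (H ⊗[ℂ] K →L[ℂ] H ⊗[ℂ] K) :=
  Algebra.TensorProduct.lift
    (AlgHom.ofLinearMap
      { toFun := fun a => (π a).rTensor K
        map_add' := fun a b => by rw [map_add, ContinuousLinearMap.rTensor_add]
        map_smul' := fun c a => by rw [map_smul, ContinuousLinearMap.rTensor_smul]; rfl }
      (by simp) (fun a b => by simp [ContinuousLinearMap.rTensor_mul]))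
    (AlgHom.ofLinearMap
      { toFun := fun b => (ρ b).lTensor H
        map_add' := fun a b => by rw [map_add, ContinuousLinearMap.lTensor_add]
        map_smul' := fun c a => by rw [map_smul, ContinuousLinearMap.lTensor_smul]; rfl }
      (by simp) (fun a b => by simp [ContinuousLinearMap.lTensor_mul]))
    (fun a b => ((π a).rTensor_comp_lTensor (ρ b)).trans ((ρ b).lTensor_comp_rTensor (π a)).symm)

theorem rep_tmul (π : A →⋆ₐ[ℂ] (H →L[ℂ] H)) (ρ : B →⋆ₐ[ℂ] (K →L[ℂ] K)) (a : A) (b : B) :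
    rep π ρ (a ⊗ₜ b) = TensorProduct.mapL (π a) (ρ b) :=
  (Algebra.TensorProduct.lift_tmul _ _ _ a b).trans ((π a).rTensor_comp_lTensor (ρ b))

theorem inner_rep_star (π : A →⋆ₐ[ℂ] (H →L[ℂ] H)) (ρ : B →⋆ₐ[ℂ] (K →L[ℂ] K)) (x : A ⊗[ℂ] B)
    (v w : H ⊗[ℂ] K) : inner ℂ (rep π ρ (star x) v) w = inner ℂ v (rep π ρ x w) := by
  induction x with
  | zero => simp
  | add x y hx hy =>
    rw [star_add, map_add, map_add, add_apply, add_apply,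
      inner_add_left, inner_add_right, hx, hy]
  | tmul a b =>
    rw [TensorProduct.star_tmul, rep_tmul, rep_tmul]
    induction v with
    | zero => simp
    | add v v' hv hv' => rw [map_add, inner_add_left, inner_add_left, hv, hv']
    | tmul h k =>
      induction w with
      | zero => simp
      | add w w' hw hw' => rw [map_add, inner_add_right, inner_add_right, hw, hw']
      | tmul h' k' =>
        rw [TensorProduct.mapL_tmul, TensorProduct.mapL_tmul, TensorProduct.inner_tmul,
          TensorProduct.inner_tmul, map_star, map_star, ContinuousLinearMap.star_eq_adjoint,
          ContinuousLinearMap.star_eq_adjoint, ContinuousLinearMap.adjoint_inner_left,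
          ContinuousLinearMap.adjoint_inner_left]

theorem norm_rep_nonneg (π : A →⋆ₐ[ℂ] (H →L[ℂ] H)) (ρ : B →⋆ₐ[ℂ] (K →L[ℂ] K)) (x : A ⊗[ℂ] B) :
    0 ≤ ‖rep π ρ x‖ := ContinuousLinearMap.opNorm_nonneg _

theorem norm_rep_mul_le (π : A →⋆ₐ[ℂ] (H →L[ℂ] H)) (ρ : B →⋆ₐ[ℂ] (K →L[ℂ] K)) (x y : A ⊗[ℂ] B) :
    ‖rep π ρ (x * y)‖ ≤ ‖rep π ρ x‖ * ‖rep π ρ y‖ := by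
  rw [map_mul]; exact ContinuousLinearMap.opNorm_comp_le _ _

theorem norm_rep_le_star (π : A →⋆ₐ[ℂ] (H →L[ℂ] H)) (ρ : B →⋆ₐ[ℂ] (K →L[ℂ] K)) (x : A ⊗[ℂ] B) :
    ‖rep π ρ x‖ ^ 2 ≤ ‖rep π ρ (star x * x)‖ := by
  have h : ‖rep π ρ x‖ ≤ Real.sqrt ‖rep π ρ (star x * x)‖ := by
    refine ContinuousLinearMap.opNorm_le_bound _ (Real.sqrt_nonneg _) (fun v => ?_)
    rw [← Real.sqrt_sq (norm_nonneg v), ← Real.sqrt_mul (norm_rep_nonneg π ρ _)]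
    apply Real.le_sqrt_of_sq_le
    have h1 : ‖rep π ρ x v‖ ^ 2 = ‖inner ℂ (rep π ρ (star x * x) v) v‖ := by
      have h2 := inner_rep_star π ρ x (rep π ρ x v) v
      rw [map_mul, mul_apply_eq_comp, h2]
      exact (norm_inner_self _).symm
    rw [h1, sq ‖v‖, ← mul_assoc]
    exact (norm_inner_le_norm _ _).trans
      (mul_le_mul_of_nonneg_right (ContinuousLinearMap.le_opNorm _ _) (norm_nonneg _))
  calc ‖rep π ρ x‖ ^ 2 ≤ Real.sqrt ‖rep π ρ (star x * x)‖ ^ 2 :=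
        pow_le_pow_left₀ (norm_rep_nonneg π ρ _) h 2
    _ = _ := Real.sq_sqrt (norm_rep_nonneg π ρ _)

/-- The C*-seminorm `x ↦ ‖(π ⊗ ρ) x‖` on the algebraic tensor product. -/
noncomputable def repSeminorm (π : A →⋆ₐ[ℂ] (H →L[ℂ] H)) (ρ : B →⋆ₐ[ℂ] (K →L[ℂ] K)) :
    CStarSeminorm (A ⊗[ℂ] B) where
  toSeminorm := (normSeminorm ℂ (H ⊗[ℂ] K →L[ℂ] H ⊗[ℂ] K)).comp (rep π ρ).toLinearMap
  mul_le' x y := by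
    change ‖rep π ρ (x * y)‖ ≤ ‖rep π ρ x‖ * ‖rep π ρ y‖
    exact norm_rep_mul_le π ρ x y
  star_mul_self' x := by
    change ‖rep π ρ (star x * x)‖ = ‖rep π ρ x‖ ^ 2
    refine le_antisymm ?_ (norm_rep_le_star π ρ x)
    have h1 : ∀ y, ‖rep π ρ (star y * y)‖ ≤ ‖rep π ρ (star y)‖ * ‖rep π ρ y‖ := fun y =>
      norm_rep_mul_le π ρ (star y) y
    have h2 : ∀ y, ‖rep π ρ y‖ ≤ ‖rep π ρ (star y)‖ := by
      intro y
      rcases (norm_rep_nonneg π ρ y).eq_or_lt with h | h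
      · rw [← h]; exact norm_rep_nonneg π ρ _
      · have h3 := (norm_rep_le_star π ρ y).trans (h1 y)
        rw [sq] at h3
        exact le_of_mul_le_mul_right h3 h
    have h4 : ‖rep π ρ (star x)‖ ≤ ‖rep π ρ x‖ := by simpa using h2 (star x)
    rw [sq]
    exact (h1 x).trans (mul_le_mul_of_nonneg_right h4 (norm_rep_nonneg π ρ x))

theorem repSeminorm_apply (π : A →⋆ₐ[ℂ] (H →L[ℂ] H)) (ρ : B →⋆ₐ[ℂ] (K →L[ℂ] K))
    (x : A ⊗[ℂ] B) : repSeminorm π ρ x = ‖rep π ρ x‖ := rfl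

theorem repSeminorm_tmul_le (π : A →⋆ₐ[ℂ] (H →L[ℂ] H)) (ρ : B →⋆ₐ[ℂ] (K →L[ℂ] K))
    (a : A) (b : B) : repSeminorm π ρ (a ⊗ₜ b) ≤ ‖a‖ * ‖b‖ := by
  rw [repSeminorm_apply, rep_tmul]
  exact (TensorProduct.norm_mapL_le _ _).trans
    (mul_le_mul (NonUnitalStarAlgHom.norm_apply_le π a) (NonUnitalStarAlgHom.norm_apply_le ρ b)
      (norm_nonneg _) (norm_nonneg _))

end Rep

variable (A B) in
/-- All C*-seminorms `x ↦ ‖(π ⊗ ρ) x‖`, where `π` and `ρ` are representations of `A` and `B` on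
Hilbert spaces. -/
def spatialSeminorms : Set (CStarSeminorm (A ⊗[ℂ] B)) :=
  {p | ∃ (H K : Type u) (_ : NormedAddCommGroup H) (_ : InnerProductSpace ℂ H)
    (_ : CompleteSpace H) (_ : NormedAddCommGroup K) (_ : InnerProductSpace ℂ K)
    (_ : CompleteSpace K) (π : A →⋆ₐ[ℂ] (H →L[ℂ] H)) (ρ : B →⋆ₐ[ℂ] (K →L[ℂ] K)),
    p = repSeminorm π ρ}

theorem bddAbove_spatialSeminorms (x : A ⊗[ℂ] B) :
    BddAbove ((fun p => p x) '' spatialSeminorms A B) := by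
  induction x with
  | zero =>
    refine ⟨0, ?_⟩
    rintro _ ⟨p, -, rfl⟩
    exact (map_zero p.toSeminorm).le
  | tmul a b =>
    refine ⟨‖a‖ * ‖b‖, ?_⟩
    rintro _ ⟨p, ⟨H, K, _, _, _, _, _, _, π, ρ, rfl⟩, rfl⟩
    exact repSeminorm_tmul_le π ρ a b
  | add x y hx hy =>
    obtain ⟨M, hM⟩ := hx
    obtain ⟨N, hN⟩ := hy
    refine ⟨M + N, ?_⟩
    rintro _ ⟨p, hp, rfl⟩
    have h1 : p x ≤ M := hM ⟨p, hp, rfl⟩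
    have h2 : p y ≤ N := hN ⟨p, hp, rfl⟩
    exact (map_add_le_add p.toSeminorm x y).trans (add_le_add h1 h2)

variable (A B) in
/-- The minimal (spatial) C*-norm `‖x‖ = sup ‖(π ⊗ ρ) x‖` on the algebraic tensor product. -/
noncomputable def seminorm : CStarSeminorm (A ⊗[ℂ] B) :=
  CStarSeminorm.sup (spatialSeminorms A B) bddAbove_spatialSeminorms

end MinTensor

/-- The minimal tensor product of two unital C*-algebras. -/
abbrev MinTensor (A B : Type u) [CStarAlgebra A] [CStarAlgebra B] : Type u :=
  (MinTensor.seminorm A B).Completion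

namespace MinTensor

variable {A B : Type u} [CStarAlgebra A] [CStarAlgebra B]

/-- The canonical map from the algebraic to the minimal tensor product. -/
noncomputable def incl : A ⊗[ℂ] B →⋆ₐ[ℂ] MinTensor A B := (seminorm A B).coe

/-- The elementary tensor `a ⊗ b` in the minimal tensor product. -/
noncomputable def tmul (a : A) (b : B) : MinTensor A B := incl (a ⊗ₜ b)

/-- The algebraic tensor product of two *-homomorphisms. -/
noncomputable def algMap {A' B' : Type u} [CStarAlgebra A'] [CStarAlgebra B'] (φ : A →⋆ₐ[ℂ] A')
    (ψ : B →⋆ₐ[ℂ] B') : A ⊗[ℂ] B →⋆ₐ[ℂ] A' ⊗[ℂ] B' where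
  __ := Algebra.TensorProduct.map (φ : A →ₐ[ℂ] A') (ψ : B →ₐ[ℂ] B')
  map_star' x := by
    change Algebra.TensorProduct.map (φ : A →ₐ[ℂ] A') (ψ : B →ₐ[ℂ] B') (star x) =
      star (Algebra.TensorProduct.map (φ : A →ₐ[ℂ] A') (ψ : B →ₐ[ℂ] B') x)
    induction x with
    | zero => simp
    | tmul a b => simp [map_star]
    | add x y hx hy => rw [star_add, map_add, map_add, star_add, hx, hy]

theorem algMap_tmul {A' B' : Type u} [CStarAlgebra A'] [CStarAlgebra B'] (φ : A →⋆ₐ[ℂ] A')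
    (ψ : B →⋆ₐ[ℂ] B') (a : A) (b : B) : algMap φ ψ (a ⊗ₜ b) = φ a ⊗ₜ ψ b := rfl

theorem seminorm_algMap_le {A' B' : Type u} [CStarAlgebra A'] [CStarAlgebra B'] (φ : A →⋆ₐ[ℂ] A')
    (ψ : B →⋆ₐ[ℂ] B') (x : A ⊗[ℂ] B) : seminorm A' B' (algMap φ ψ x) ≤ seminorm A B x := by
  refine CStarSeminorm.sup_le _ _ (CStarSeminorm.nonneg _ _) ?_
  rintro p ⟨H, K, _, _, _, _, _, _, π, ρ, rfl⟩
  have h : ∀ x, rep π ρ (algMap φ ψ x) = rep (π.comp φ) (ρ.comp ψ) x := by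
    intro x
    induction x with
    | zero => simp
    | tmul a b => rw [algMap_tmul, rep_tmul, rep_tmul]; rfl
    | add x y hx hy => rw [map_add, map_add, map_add, hx, hy]
  rw [repSeminorm_apply, h, ← repSeminorm_apply]
  exact CStarSeminorm.le_sup _ bddAbove_spatialSeminorms
    ⟨H, K, _, _, _, _, _, _, π.comp φ, ρ.comp ψ, rfl⟩ x

/-- The tensor product `φ ⊗ ψ` of two *-homomorphisms on minimal tensor products. -/
noncomputable def map {A' B' : Type u} [CStarAlgebra A'] [CStarAlgebra B'] (φ : A →⋆ₐ[ℂ] A')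
    (ψ : B →⋆ₐ[ℂ] B') : MinTensor A B →⋆ₐ[ℂ] MinTensor A' B' :=
  (seminorm A B).lift (incl.comp (algMap φ ψ)) (fun x => by
    change ‖(seminorm A' B').coe (algMap φ ψ x)‖ ≤ _
    rw [CStarSeminorm.norm_coe_apply]
    exact seminorm_algMap_le φ ψ x)

theorem map_tmul {A' B' : Type u} [CStarAlgebra A'] [CStarAlgebra B'] (φ : A →⋆ₐ[ℂ] A')
    (ψ : B →⋆ₐ[ℂ] B') (a : A) (b : B) : map φ ψ (tmul a b) = tmul (φ a) (ψ b) :=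
  CStarSeminorm.lift_coe _ _ _ _

theorem tmul_mul_tmul (a a' : A) (b b' : B) :
    tmul a b * tmul a' b' = tmul (a * a') (b * b') := by
  rw [tmul, tmul, tmul, ← map_mul, Algebra.TensorProduct.tmul_mul_tmul]

theorem star_tmul (a : A) (b : B) : star (tmul a b) = tmul (star a) (star b) := by
  rw [tmul, tmul, ← map_star, TensorProduct.star_tmul]

theorem one_tmul_one : tmul (1 : A) (1 : B) = 1 := by
  rw [tmul, ← Algebra.TensorProduct.one_def, map_one]

theorem zero_tmul (b : B) : tmul (0 : A) b = 0 := by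
  rw [tmul, TensorProduct.zero_tmul, map_zero]

theorem tmul_zero (a : A) : tmul a (0 : B) = 0 := by
  rw [tmul, TensorProduct.tmul_zero, map_zero]

theorem sum_tmul {ι : Type*} (s : Finset ι) (f : ι → A) (b : B) :
    tmul (∑ i ∈ s, f i) b = ∑ i ∈ s, tmul (f i) b := by
  simp_rw [tmul]
  rw [TensorProduct.sum_tmul, map_sum]

theorem tmul_sum {ι : Type*} (s : Finset ι) (a : A) (f : ι → B) :
    tmul a (∑ i ∈ s, f i) = ∑ i ∈ s, tmul a (f i) := by
  simp_rw [tmul]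
  rw [TensorProduct.tmul_sum, map_sum]

end MinTensor

/-! ### Compact matrix quantum groups -/

/-- A compact matrix quantum group `(C(G), u)` with fundamental representation `u` indexed by `ι`:
`C(G)` is a unital C*-algebra generated by the entries of `u`, the matrices `[u i j]` and
`[(u i j)*]` are invertible, and `Δ (u i j) = ∑ k, u i k ⊗ u k j` defines a unital *-homomorphism
`Δ : C(G) → C(G) ⊗ C(G)` into the minimal tensor product. -/
structure CompactMatrixQuantumGroup (ι : Type u) [Fintype ι] [DecidableEq ι] where
  /-- The C*-algebra `C(G)`. -/
  Carrier : Type u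
  [cstar : CStarAlgebra Carrier]
  /-- The fundamental representation `u`. -/
  fund : Matrix ι ι Carrier
  generates : (StarAlgebra.adjoin ℂ
    (Set.range fun ij : ι × ι => fund ij.1 ij.2)).topologicalClosure = ⊤
  isUnit_fund : IsUnit fund
  isUnit_conj : IsUnit (fund.map star)
  /-- The comultiplication `Δ`. -/
  comul : Carrier →⋆ₐ[ℂ] MinTensor Carrier Carrier
  comul_fund : ∀ i j, comul (fund i j) = ∑ k, MinTensor.tmul (fund i k) (fund k j)

attribute [instance] CompactMatrixQuantumGroup.cstar

/-- Two compact matrix quantum groups are the same if there is a *-isomorphism of their C*-algebras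
that carries one fundamental representation to the other and intertwines the comultiplications. -/
def CompactMatrixQuantumGroup.Same {ι : Type u} [Fintype ι] [DecidableEq ι]
    (G H : CompactMatrixQuantumGroup ι) : Prop :=
  ∃ φ : G.Carrier ≃⋆ₐ[ℂ] H.Carrier, (∀ i j, φ (G.fund i j) = H.fund i j) ∧
    ∀ a, H.comul (φ a) =
      MinTensor.map (φ : G.Carrier →⋆ₐ[ℂ] H.Carrier) (φ : G.Carrier →⋆ₐ[ℂ] H.Carrier) (G.comul a)

/-! ### Magic unitaries -/

/-- A magic unitary: a matrix of projections (in a *-algebra) whose rows and columns sum to `1`. -/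
structure IsMagicUnitary {ι κ A : Type*} [Fintype ι] [Fintype κ] [Ring A] [StarRing A]
    (w : Matrix ι κ A) : Prop where
  star_eq : ∀ i j, star (w i j) = w i j
  mul_self : ∀ i j, w i j * w i j = w i j
  sum_row : ∀ i, ∑ j, w i j = 1
  sum_col : ∀ j, ∑ i, w i j = 1

/-- Projections in a C*-algebra with sum `1` are pairwise orthogonal. -/
theorem mul_eq_zero_of_sum_eq_one {ι A : Type*} [Fintype ι] [CStarAlgebra A] (q : ι → A)
    (hs : ∀ i, star (q i) = q i) (hm : ∀ i, q i * q i = q i) (h1 : ∑ i, q i = 1) {i j : ι}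
    (hij : i ≠ j) : q i * q j = 0 := by
  classical
  let _ := CStarAlgebra.spectralOrder A
  have := CStarAlgebra.spectralOrderedRing A
  have h2 : ∑ k, q j * q k * q j = q j := by
    rw [← Finset.sum_mul, ← Finset.mul_sum, h1, mul_one, hm]
  rw [← Finset.add_sum_erase _ _ (Finset.mem_univ j), hm, hm, add_eq_left] at h2
  have h3 : ∀ k, q j * q k * q j = star (q k * q j) * (q k * q j) := fun k => by
    rw [star_mul, hs, hs, mul_assoc, mul_assoc, ← mul_assoc (q k) (q k), hm]
  rw [Finset.sum_eq_zero_iff_of_nonneg (fun k _ => by rw [h3]; exact star_mul_self_nonneg _)] at h2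
  have h4 := h2 i (Finset.mem_erase.2 ⟨hij, Finset.mem_univ _⟩)
  rw [h3] at h4
  exact CStarRing.star_mul_self_eq_zero_iff _ |>.1 h4

namespace IsMagicUnitary

variable {ι A : Type*} [Fintype ι] [CStarAlgebra A] {w : Matrix ι ι A}

theorem row_orthogonal (hw : IsMagicUnitary w) {i j k : ι} (h : j ≠ k) : w i j * w i k = 0 :=
  mul_eq_zero_of_sum_eq_one (fun j => w i j) (hw.star_eq i) (hw.mul_self i) (hw.sum_row i) h

theorem col_orthogonal (hw : IsMagicUnitary w) {i j k : ι} (h : j ≠ k) : w j i * w k i = 0 :=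
  mul_eq_zero_of_sum_eq_one (fun j => w j i) (fun j => hw.star_eq j i) (fun j => hw.mul_self j i)
    (hw.sum_col i) h

theorem isUnit [DecidableEq ι] (hw : IsMagicUnitary w) : IsUnit w := by
  refine ⟨⟨w, w.transpose, ?_, ?_⟩, rfl⟩
  · ext i j
    rw [Matrix.mul_apply, Matrix.one_apply]
    simp only [Matrix.transpose_apply]
    split_ifs with h
    · subst h; simp_rw [hw.mul_self]; exact hw.sum_row i
    · exact Finset.sum_eq_zero (fun k _ => hw.col_orthogonal h)
  · ext i j
    rw [Matrix.mul_apply, Matrix.one_apply]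
    simp only [Matrix.transpose_apply]
    split_ifs with h
    · subst h; simp_rw [hw.mul_self]; exact hw.sum_col i
    · exact Finset.sum_eq_zero (fun k _ => hw.row_orthogonal h)

theorem map_star_eq (hw : IsMagicUnitary w) : w.map star = w := by
  ext i j; exact hw.star_eq i j

end IsMagicUnitary

/-! ### Colored graphs -/

/-- A (simple) vertex-colored graph on the vertex set `V` with colors in `C`. -/
structure ColoredGraph (V C : Type*) where
  /-- The underlying graph. -/
  graph : SimpleGraph V
  /-- The coloring; adjacent vertices may have the same color. -/
  color : V → C

namespace ColoredGraph

/-- The disjoint union of a family of colored graphs. -/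
def disjointUnion {I C : Type*} {V : I → Type*} (X : ∀ i, ColoredGraph (V i) C) :
    ColoredGraph (Σ i, V i) C where
  graph :=
    { Adj := fun x y => ∃ (i : I) (a b : V i), (X i).graph.Adj a b ∧ x = ⟨i, a⟩ ∧ y = ⟨i, b⟩
      symm := ⟨by rintro _ _ ⟨i, a, b, h, rfl, rfl⟩; exact ⟨i, b, a, h.symm, rfl, rfl⟩⟩
      loopless := ⟨by
        rintro _ ⟨i, a, b, h, rfl, h'⟩
        cases h'
        exact h.ne rfl⟩ }
  color := fun x => (X x.1).color x.2

/-- A connected component of a colored graph, as a colored graph on its own vertex set. -/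
def component {V C : Type*} (X : ColoredGraph V C) (K : X.graph.ConnectedComponent) :
    ColoredGraph K C where
  graph := K.toSimpleGraph
  color := fun x => X.color x

open Classical in
/-- Quantum isomorphism of finite colored graphs: there is a magic unitary `u`, indexed by
`V(X) × V(Y)` and with entries in a nonzero unital C*-algebra, such that `A_X u = u A_Y` and
`u x y = 0` whenever `x` and `y` have different colors. -/
def QuantumIsomorphic {V W : Type u} {C : Type*} [Fintype V] [Fintype W] (X : ColoredGraph V C)
    (Y : ColoredGraph W C) : Prop :=
  ∃ (A : Type u) (_ : CStarAlgebra A) (_ : Nontrivial A) (w : Matrix V W A),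
    IsMagicUnitary w ∧ X.graph.adjMatrix A * w = w * Y.graph.adjMatrix A ∧
      ∀ x y, X.color x ≠ Y.color y → w x y = 0

noncomputable instance componentFintype {V C : Type*} [Fintype V] (X : ColoredGraph V C)
    (K : X.graph.ConnectedComponent) : Fintype K := Fintype.ofFinite K

/-! ### The quantum automorphism group of a colored graph -/

section Qut

variable {V : Type u} {C : Type*} [Fintype V] (X : ColoredGraph V C)

/-- The defining relations (`r = 0`) of the quantum automorphism group of a colored graph. -/
inductive QutRel : FreeStarAlgebra (V × V) → Prop
  | star_eq (i j : V) : QutRel (star (FreeStarAlgebra.of (i, j)) - FreeStarAlgebra.of (i, j))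
  | mul_self (i j : V) : QutRel
      (FreeStarAlgebra.of (i, j) * FreeStarAlgebra.of (i, j) - FreeStarAlgebra.of (i, j))
  | sum_row (i : V) : QutRel (∑ k, FreeStarAlgebra.of (i, k) - 1)
  | sum_col (j : V) : QutRel (∑ k, FreeStarAlgebra.of (k, j) - 1)
  | adj_left (i j k l : V) : X.graph.Adj i k → ¬ X.graph.Adj j l →
      QutRel (FreeStarAlgebra.of (i, j) * FreeStarAlgebra.of (k, l))
  | adj_right (i j k l : V) : ¬ X.graph.Adj i k → X.graph.Adj j l →
      QutRel (FreeStarAlgebra.of (i, j) * FreeStarAlgebra.of (k, l))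
  | color (i j : V) : X.color i ≠ X.color j → QutRel (FreeStarAlgebra.of (i, j))

/-- The set of defining relations of the quantum automorphism group. -/
def qutRelations : Set (FreeStarAlgebra (V × V)) := {r | X.QutRel r}

theorem isBounded_qutRelations : UniversalCStar.IsBounded X.qutRelations := by
  rintro ⟨i, j⟩
  refine ⟨1, ?_⟩
  rintro _ ⟨p, hp, rfl⟩
  have h0 : ∀ r, X.QutRel r → p.coe r = 0 := fun r hr => by
    rw [← norm_eq_zero, p.norm_coe_apply]; exact hp r hr
  have h1 := h0 _ (QutRel.star_eq i j)
  have h2 := h0 _ (QutRel.mul_self i j)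
  rw [map_sub, sub_eq_zero] at h1 h2
  rw [map_star] at h1
  rw [map_mul] at h2
  change p _ ≤ 1
  rw [← p.norm_coe_apply]
  exact IsStarProjection.norm_le _ ⟨h2, h1⟩

/-- The universal C*-algebra `C(Qut_c(X))`. -/
abbrev QutAlgebra : Type u := UniversalCStar X.qutRelations X.isBounded_qutRelations

/-- The generators `u i j` of `C(Qut_c(X))`. -/
noncomputable def qutFund : Matrix V V X.QutAlgebra :=
  Matrix.of fun i j => UniversalCStar.gen X.qutRelations X.isBounded_qutRelations (i, j)

/-- The matrices over a C*-algebra that satisfy the defining relations of `Qut_c(X)`. -/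
structure IsQutMatrix {A : Type*} [CStarAlgebra A] (w : Matrix V V A) : Prop where
  magic : IsMagicUnitary w
  adj_left : ∀ i j k l, X.graph.Adj i k → ¬ X.graph.Adj j l → w i j * w k l = 0
  adj_right : ∀ i j k l, ¬ X.graph.Adj i k → X.graph.Adj j l → w i j * w k l = 0
  color : ∀ i j, X.color i ≠ X.color j → w i j = 0

theorem isQutMatrix_qutFund : X.IsQutMatrix X.qutFund := by
  have h0 : ∀ r, X.QutRel r → UniversalCStar.mk X.qutRelations X.isBounded_qutRelations r = 0 :=
    fun r hr => UniversalCStar.mk_eq_zero _ _ hr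
  refine ⟨⟨fun i j => ?_, fun i j => ?_, fun i => ?_, fun j => ?_⟩, fun i j k l h h' => ?_,
    fun i j k l h h' => ?_, fun i j h => ?_⟩
  · have h := h0 _ (QutRel.star_eq i j)
    rwa [map_sub, map_star, sub_eq_zero] at h
  · have h := h0 _ (QutRel.mul_self i j)
    rwa [map_sub, map_mul, sub_eq_zero] at h
  · have h := h0 _ (QutRel.sum_row i)
    rwa [map_sub, map_sum, map_one, sub_eq_zero] at h
  · have h := h0 _ (QutRel.sum_col j)
    rwa [map_sub, map_sum, map_one, sub_eq_zero] at h
  · have h := h0 _ (QutRel.adj_left i j k l h h')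
    rwa [map_mul] at h
  · have h := h0 _ (QutRel.adj_right i j k l h h')
    rwa [map_mul] at h
  · exact h0 _ (QutRel.color i j h)

/-- The universal property of `C(Qut_c(X))`. -/
noncomputable def qutLift {A : Type*} [CStarAlgebra A] (w : Matrix V V A) (hw : X.IsQutMatrix w) :
    X.QutAlgebra →⋆ₐ[ℂ] A :=
  UniversalCStar.lift _ _ (fun ij : V × V => w ij.1 ij.2) (by
    intro r hr
    change X.QutRel r at hr
    induction hr with
    | star_eq i j =>
      rw [map_sub, map_star, FreeStarAlgebra.lift_of, hw.magic.star_eq, sub_self]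
    | mul_self i j =>
      rw [map_sub, map_mul, FreeStarAlgebra.lift_of, hw.magic.mul_self, sub_self]
    | sum_row i =>
      simp_rw [map_sub, map_sum, FreeStarAlgebra.lift_of, hw.magic.sum_row, map_one, sub_self]
    | sum_col j =>
      simp_rw [map_sub, map_sum, FreeStarAlgebra.lift_of, hw.magic.sum_col, map_one, sub_self]
    | adj_left i j k l h h' =>
      rw [map_mul, FreeStarAlgebra.lift_of, FreeStarAlgebra.lift_of]
      exact hw.adj_left i j k l h h'
    | adj_right i j k l h h' =>
      rw [map_mul, FreeStarAlgebra.lift_of, FreeStarAlgebra.lift_of]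
      exact hw.adj_right i j k l h h'
    | color i j h =>
      rw [FreeStarAlgebra.lift_of]
      exact hw.color i j h)

theorem qutLift_fund {A : Type*} [CStarAlgebra A] (w : Matrix V V A) (hw : X.IsQutMatrix w)
    (i j : V) : X.qutLift w hw (X.qutFund i j) = w i j :=
  UniversalCStar.lift_gen _ _ _ _ _

/-- The matrix `∑ k, w i k ⊗ w k j` again satisfies the relations of `Qut_c(X)`. -/
theorem IsQutMatrix.comul [DecidableEq V] {A : Type u} [CStarAlgebra A] {w : Matrix V V A}
    (hw : X.IsQutMatrix w) :
    X.IsQutMatrix (Matrix.of fun i j => ∑ k, MinTensor.tmul (w i k) (w k j)) := by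
  have prod : ∀ i j k l, (∑ a, MinTensor.tmul (w i a) (w a j)) *
      (∑ b, MinTensor.tmul (w k b) (w b l)) =
      ∑ a, ∑ b, MinTensor.tmul (w i a * w k b) (w a j * w b l) := fun i j k l => by
    simp_rw [Finset.sum_mul_sum, MinTensor.tmul_mul_tmul]
  refine ⟨⟨fun i j => ?_, fun i j => ?_, fun i => ?_, fun j => ?_⟩, fun i j k l h h' => ?_,
    fun i j k l h h' => ?_, fun i j h => ?_⟩ <;> simp only [Matrix.of_apply]
  · simp_rw [star_sum, MinTensor.star_tmul, hw.magic.star_eq]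
  · rw [prod]
    refine Finset.sum_congr rfl (fun a _ => ?_)
    rw [Finset.sum_eq_single a, hw.magic.mul_self, hw.magic.mul_self]
    · intro b _ hb
      rw [hw.magic.row_orthogonal hb.symm, MinTensor.zero_tmul]
    · exact fun h => (h (Finset.mem_univ a)).elim
  · rw [Finset.sum_comm]
    simp_rw [← MinTensor.tmul_sum, hw.magic.sum_row, ← MinTensor.sum_tmul, hw.magic.sum_row,
      MinTensor.one_tmul_one]
  · rw [Finset.sum_comm]
    simp_rw [← MinTensor.sum_tmul, hw.magic.sum_col, ← MinTensor.tmul_sum, hw.magic.sum_col,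
      MinTensor.one_tmul_one]
  · rw [prod]
    refine Finset.sum_eq_zero (fun a _ => Finset.sum_eq_zero (fun b _ => ?_))
    by_cases hab : X.graph.Adj a b
    · rw [hw.adj_left a j b l hab h', MinTensor.tmul_zero]
    · rw [hw.adj_left i a k b h hab, MinTensor.zero_tmul]
  · rw [prod]
    refine Finset.sum_eq_zero (fun a _ => Finset.sum_eq_zero (fun b _ => ?_))
    by_cases hab : X.graph.Adj a b
    · rw [hw.adj_right i a k b h hab, MinTensor.zero_tmul]
    · rw [hw.adj_right a j b l hab h', MinTensor.tmul_zero]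
  · refine Finset.sum_eq_zero (fun a _ => ?_)
    by_cases ha : X.color i = X.color a
    · rw [hw.color a j (fun h' => h (ha.trans h')), MinTensor.tmul_zero]
    · rw [hw.color i a ha, MinTensor.zero_tmul]

/-- The quantum automorphism group `Qut_c(X)` of a finite colored graph. -/
noncomputable def qut [DecidableEq V] : CompactMatrixQuantumGroup V where
  Carrier := X.QutAlgebra
  fund := X.qutFund
  generates := UniversalCStar.topologicalClosure_adjoin_gen X.qutRelations X.isBounded_qutRelations
  isUnit_fund := X.isQutMatrix_qutFund.magic.isUnit
  isUnit_conj := by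
    rw [X.isQutMatrix_qutFund.magic.map_star_eq]
    exact X.isQutMatrix_qutFund.magic.isUnit
  comul := X.qutLift _ X.isQutMatrix_qutFund.comul
  comul_fund := X.qutLift_fund _ X.isQutMatrix_qutFund.comul

end Qut

end ColoredGraph

/-! ### Free products -/

namespace FreeProductCStar

variable {I : Type} (A : I → Type u) [∀ i, CStarAlgebra (A i)]

/-- The relations (`r = 0`) of the unital free product of the `A i`: its generators are the elements
of the `A i`, and all algebraic relations of each `A i` are imposed; the units are identified. -/
inductive Rel : FreeStarAlgebra (Σ i, A i) → Prop
  | add (i : I) (a b : A i) : Rel (FreeStarAlgebra.of ⟨i, a + b⟩ -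
      (FreeStarAlgebra.of ⟨i, a⟩ + FreeStarAlgebra.of ⟨i, b⟩))
  | mul (i : I) (a b : A i) : Rel (FreeStarAlgebra.of ⟨i, a * b⟩ -
      FreeStarAlgebra.of ⟨i, a⟩ * FreeStarAlgebra.of ⟨i, b⟩)
  | star (i : I) (a : A i) : Rel (FreeStarAlgebra.of ⟨i, star a⟩ - star (FreeStarAlgebra.of ⟨i, a⟩))
  | scalar (i : I) (c : ℂ) : Rel (FreeStarAlgebra.of ⟨i, algebraMap ℂ (A i) c⟩ - algebraMap ℂ _ c)

/-- The set of relations of the free product. -/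
def relations : Set (FreeStarAlgebra (Σ i, A i)) := {r | Rel A r}

variable {A} in
/-- A *-homomorphism of the free *-algebra killing the relations gives *-homomorphisms on the
factors. -/
noncomputable def factorHom {B : Type*} [CStarAlgebra B] (f : FreeStarAlgebra (Σ i, A i) →⋆ₐ[ℂ] B)
    (hf : ∀ r, Rel A r → f r = 0) (i : I) : A i →⋆ₐ[ℂ] B where
  toFun a := f (FreeStarAlgebra.of ⟨i, a⟩)
  map_one' := by
    have h := hf _ (Rel.scalar i 1)
    rwa [map_sub, map_one, map_one, map_one, sub_eq_zero] at h
  map_zero' := by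
    have h := hf _ (Rel.scalar i 0)
    rwa [map_sub, map_zero, map_zero, map_zero, sub_zero] at h
  map_add' a b := by
    have h := hf _ (Rel.add i a b)
    rwa [map_sub, map_add, sub_eq_zero] at h
  map_mul' a b := by
    have h := hf _ (Rel.mul i a b)
    rwa [map_sub, map_mul, sub_eq_zero] at h
  commutes' c := by
    have h := hf _ (Rel.scalar i c)
    rwa [map_sub, AlgHomClass.commutes, sub_eq_zero] at h
  map_star' a := by
    have h := hf _ (Rel.star i a)
    rwa [map_sub, map_star, sub_eq_zero] at h

theorem isBounded_relations : UniversalCStar.IsBounded (relations A) := by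
  rintro ⟨i, a⟩
  refine ⟨‖a‖, ?_⟩
  rintro _ ⟨p, hp, rfl⟩
  have h0 : ∀ r, Rel A r → p.coe r = 0 := fun r hr => by
    rw [← norm_eq_zero, p.norm_coe_apply]; exact hp r hr
  change p _ ≤ _
  rw [← p.norm_coe_apply]
  exact NonUnitalStarAlgHom.norm_apply_le (factorHom p.coe h0 i) a

end FreeProductCStar

/-- The unital free product of a family of unital C*-algebras. -/
abbrev FreeProductCStar {I : Type} (A : I → Type u) [∀ i, CStarAlgebra (A i)] : Type u :=
  UniversalCStar (FreeProductCStar.relations A) (FreeProductCStar.isBounded_relations A)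

namespace FreeProductCStar

variable {I : Type} {A : I → Type u} [∀ i, CStarAlgebra (A i)]

/-- The canonical *-homomorphism of a factor into the free product. -/
noncomputable def incl (i : I) : A i →⋆ₐ[ℂ] FreeProductCStar A :=
  factorHom (UniversalCStar.mk (relations A) (isBounded_relations A))
    (fun _ hr => UniversalCStar.mk_eq_zero _ _ hr) i

/-- The universal property of the free product. -/
noncomputable def lift {B : Type*} [CStarAlgebra B] (f : ∀ i, A i →⋆ₐ[ℂ] B) :
    FreeProductCStar A →⋆ₐ[ℂ] B :=
  UniversalCStar.lift _ _ (fun x : Σ i, A i => f x.1 x.2) (by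
    intro r hr
    change Rel A r at hr
    induction hr with
    | add i a b => simp_rw [map_sub, map_add, FreeStarAlgebra.lift_of, map_add, sub_self]
    | mul i a b => simp_rw [map_sub, map_mul, FreeStarAlgebra.lift_of, map_mul, sub_self]
    | star i a => simp_rw [map_sub, map_star, FreeStarAlgebra.lift_of, map_star, sub_self]
    | scalar i c =>
      simp_rw [map_sub, FreeStarAlgebra.lift_of, AlgHomClass.commutes, sub_self])

theorem lift_incl {B : Type*} [CStarAlgebra B] (f : ∀ i, A i →⋆ₐ[ℂ] B) (i : I) (a : A i) :
    lift f (incl i a) = f i a :=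
  UniversalCStar.lift_gen _ _ (fun x : Σ i, A i => f x.1 x.2) _ ⟨i, a⟩

end FreeProductCStar

namespace CompactMatrixQuantumGroup

theorem isUnit_map_matrix {κ A B : Type*} [Fintype κ] [DecidableEq κ] [CStarAlgebra A]
    [CStarAlgebra B] (f : A →⋆ₐ[ℂ] B) {M : Matrix κ κ A} (hM : IsUnit M) : IsUnit (M.map f) :=
  hM.map (RingHom.mapMatrix (f : A →+* B))

variable {I : Type} [DecidableEq I] {ι : I → Type u} [∀ i, Fintype (ι i)]
  [∀ i, DecidableEq (ι i)] (G : ∀ i, CompactMatrixQuantumGroup (ι i))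

/-- The canonical *-homomorphism of `C(G i)` into the free product of the C*-algebras `C(G i)`. -/
noncomputable def freeProductIncl (i : I) :
    (G i).Carrier →⋆ₐ[ℂ] FreeProductCStar fun i => (G i).Carrier :=
  FreeProductCStar.incl (A := fun i => (G i).Carrier) i

/-- The images of the fundamental representations in the free product. -/
noncomputable def freeProductBlock (i : I) :
    Matrix (ι i) (ι i) (FreeProductCStar fun i => (G i).Carrier) :=
  (G i).fund.map (freeProductIncl G i)

/-- The block diagonal matrix `⊕ i, u⁽ⁱ⁾` over the free product. -/
noncomputable def freeProductFund :
    Matrix (Σ i, ι i) (Σ i, ι i) (FreeProductCStar fun i => (G i).Carrier) :=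
  Matrix.blockDiagonal' (freeProductBlock G)

/-- The comultiplication of the free product. -/
noncomputable def freeProductComul : (FreeProductCStar fun i => (G i).Carrier) →⋆ₐ[ℂ]
    MinTensor (FreeProductCStar fun i => (G i).Carrier) (FreeProductCStar fun i => (G i).Carrier) :=
  FreeProductCStar.lift fun i =>
    (MinTensor.map (freeProductIncl G i) (freeProductIncl G i)).comp (G i).comul

theorem freeProduct_generates : (StarAlgebra.adjoin ℂ (Set.range
    fun x : (Σ i, ι i) × (Σ i, ι i) => freeProductFund G x.1 x.2)).topologicalClosure = ⊤ := by
  set T := (StarAlgebra.adjoin ℂ (Set.range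
    fun x : (Σ i, ι i) × (Σ i, ι i) => freeProductFund G x.1 x.2)).topologicalClosure with hT
  have hcont : ∀ i, Continuous (freeProductIncl G i) := fun i =>
    (AddMonoidHomClass.lipschitz_of_bound _ 1 (fun a => by
      rw [one_mul]; exact NonUnitalStarAlgHom.norm_apply_le _ a)).continuous
  have key : ∀ i (a : (G i).Carrier),
      freeProductIncl G i a ∈ T := by
    intro i a
    have h1 : (StarAlgebra.adjoin ℂ (Set.range fun ij : ι i × ι i => (G i).fund ij.1 ij.2)) ≤
        T.comap (freeProductIncl G i) := by
      rw [StarAlgebra.adjoin_le_iff]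
      rintro _ ⟨⟨k, l⟩, rfl⟩
      change freeProductIncl G i ((G i).fund k l) ∈ T
      apply StarSubalgebra.le_topologicalClosure
      apply StarAlgebra.subset_adjoin
      exact ⟨(⟨i, k⟩, ⟨i, l⟩), Matrix.blockDiagonal'_apply_eq (freeProductBlock G) i k l⟩
    have h2 : IsClosed ((T.comap (freeProductIncl G i) :
        StarSubalgebra ℂ (G i).Carrier) : Set (G i).Carrier) :=
      (StarSubalgebra.isClosed_topologicalClosure _).preimage (hcont i)
    have h3 := StarSubalgebra.topologicalClosure_minimal h1 h2
    rw [(G i).generates] at h3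
    exact h3 (StarSubalgebra.mem_top (x := a))
  have h4 := UniversalCStar.topologicalClosure_adjoin_gen
    (FreeProductCStar.relations fun i => (G i).Carrier) (FreeProductCStar.isBounded_relations _)
  rw [eq_top_iff, ← h4]
  apply StarSubalgebra.topologicalClosure_minimal _ (StarSubalgebra.isClosed_topologicalClosure _)
  rw [StarAlgebra.adjoin_le_iff]
  rintro _ ⟨⟨i, a⟩, rfl⟩
  exact key i a

/-- The free product of compact matrix quantum groups: the free product of the C*-algebras with the
direct sum of the fundamental representations. -/
noncomputable def freeProduct [Fintype I] : CompactMatrixQuantumGroup (Σ i, ι i) where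
  Carrier := FreeProductCStar fun i => (G i).Carrier
  fund := freeProductFund G
  generates := freeProduct_generates G
  isUnit_fund := by
    have h : ∀ i, IsUnit (freeProductBlock G i) := fun i =>
      isUnit_map_matrix (freeProductIncl G i) (G i).isUnit_fund
    exact (Pi.isUnit_iff.2 h).map (Matrix.blockDiagonal'RingHom ι _)
  isUnit_conj := by
    have h : ∀ i, IsUnit ((freeProductBlock G i).map star) := fun i => by
      have h1 : (freeProductBlock G i).map star =
          ((G i).fund.map star).map (freeProductIncl G i) := by
        ext k l
        exact (map_star (freeProductIncl G i) ((G i).fund k l)).symm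
      rw [h1]
      exact isUnit_map_matrix (freeProductIncl G i) (G i).isUnit_conj
    rw [freeProductFund, Matrix.blockDiagonal'_map _ _ (star_zero _)]
    exact (Pi.isUnit_iff.2 h).map (Matrix.blockDiagonal'RingHom ι _)
  comul := freeProductComul G
  comul_fund := by
    rintro ⟨i, k⟩ ⟨j, l⟩
    rw [Fintype.sum_sigma]
    by_cases hij : i = j
    · subst hij
      rw [Finset.sum_eq_single i]
      · simp only [freeProductFund, Matrix.blockDiagonal'_apply_eq, freeProductBlock,
          Matrix.map_apply]
        rw [freeProductComul, freeProductIncl, FreeProductCStar.lift_incl, StarAlgHom.comp_apply,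
          (G i).comul_fund, map_sum]
        simp_rw [MinTensor.map_tmul]
        rfl
      · intro m _ hm
        refine Finset.sum_eq_zero (fun a _ => ?_)
        rw [freeProductFund, Matrix.blockDiagonal'_apply_ne _ _ _ hm.symm, MinTensor.zero_tmul]
      · exact fun h => (h (Finset.mem_univ i)).elim
    · rw [freeProductFund, Matrix.blockDiagonal'_apply_ne _ _ _ hij, map_zero]
      symm
      refine Finset.sum_eq_zero (fun m _ => Finset.sum_eq_zero (fun a _ => ?_))
      by_cases him : i = m
      · subst him
        rw [Matrix.blockDiagonal'_apply_ne _ a l hij, MinTensor.tmul_zero]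
      · rw [Matrix.blockDiagonal'_apply_ne _ k a him, MinTensor.zero_tmul]

end CompactMatrixQuantumGroup

/-! Let `w` be a quantum isomorphism between two graphs, `K` a component of the first and `L` a
component of the second. The adjacency relations make `∑ y ∈ L, w x y` independent of `x ∈ K`, and
symmetrically `∑ x ∈ K, w x y` independent of `y ∈ L`. Call these projections `p` and `q`. Summing
the whole block gives `|K| • p = |L| • q`, which forces `p = q`, so the block is a quantum
isomorphism from `K` to `L` over the corner `p A p`, unless it vanishes.

Hence, when components of different graphs are never quantum isomorphic, the fundamental
representation of the quantum automorphism group of the disjoint union is block diagonal. A block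
diagonal matrix satisfies the relations of the disjoint union if and only if each of its blocks
satisfies those of the corresponding graph, so the two universal C*-algebras map to each other
respecting the generators. As the generators are dense, these maps are mutually inverse and
intertwine the comultiplications.
-/

/-! ### Idempotents with proportional sums -/

theorem eq_of_nsmul_eq_nsmul_of_isIdempotentElem {R : Type*} [NonUnitalRing R] [IsAddTorsionFree R]
    {p q : R} (hp : IsIdempotentElem p) (hq : IsIdempotentElem q) {m n : ℕ} (hm : m ≠ 0)
    (hn : n ≠ 0) (h : m • p = n • q) : p = q := by
  have hpq : p * q = p := (nsmul_right_inj hm).1 <| by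
    rw [← smul_mul_assoc, h, smul_mul_assoc, hq.eq]
  have hqp : p * q = q := (nsmul_right_inj hn).1 <| by
    rw [← mul_smul_comm, ← h, mul_smul_comm, hp.eq]
  exact hpq.symm.trans hqp

theorem eq_of_sum_row_eq_of_sum_col_eq {ι κ R : Type*} [Fintype ι] [Fintype κ] [Nonempty ι]
    [Nonempty κ] [NonUnitalRing R] [IsAddTorsionFree R] {M : Matrix ι κ R} {p q : R}
    (hp : IsIdempotentElem p) (hq : IsIdempotentElem q) (hrow : ∀ i, ∑ j, M i j = p)
    (hcol : ∀ j, ∑ i, M i j = q) : p = q := by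
  refine eq_of_nsmul_eq_nsmul_of_isIdempotentElem hp hq (Fintype.card_ne_zero (α := ι))
    (Fintype.card_ne_zero (α := κ)) ?_
  calc Fintype.card ι • p = ∑ i, ∑ j, M i j := by simp [hrow]
    _ = ∑ j, ∑ i, M i j := Finset.sum_comm
    _ = Fintype.card κ • q := by simp [hcol]

/-! ### Corners of C*-algebras -/

/-- The corner `p A p` of a C*-algebra `A` at a projection `p`. It does not contain the unit of
`A`, but is a unital C*-algebra with unit `p`. -/
def cornerSubalgebra {A : Type*} [CStarAlgebra A] {p : A} (hp : IsStarProjection p) :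
    NonUnitalStarSubalgebra ℂ A where
  __ := NonUnitalSubsemiring.corner p
  smul_mem' := by
    rintro c _ ⟨a, rfl⟩
    exact ⟨c • a, by simp only [mul_smul_comm, smul_mul_assoc]⟩
  star_mem' := by
    rintro _ ⟨a, rfl⟩
    exact ⟨star a, by simp only [star_mul, hp.isSelfAdjoint.star_eq, mul_assoc]⟩

namespace cornerSubalgebra

variable {A : Type*} [CStarAlgebra A] {p : A} {hp : IsStarProjection p}

theorem mem_iff {a : A} : a ∈ cornerSubalgebra hp ↔ p * a = a ∧ a * p = a :=
  Subsemigroup.mem_corner_iff hp.isIdempotentElem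

instance isClosed : IsClosed (cornerSubalgebra hp : Set A) := by
  have h : (cornerSubalgebra hp : Set A) = {a | p * a = a} ∩ {a | a * p = a} :=
    Set.ext fun _ => mem_iff
  rw [h]
  exact (isClosed_eq (by fun_prop) continuous_id).inter (isClosed_eq (by fun_prop) continuous_id)

noncomputable instance : NormedRing (cornerSubalgebra hp) where
  __ := (inferInstance : NonUnitalNormedRing (cornerSubalgebra hp))
  one := ⟨p, mem_iff.2 ⟨hp.isIdempotentElem, hp.isIdempotentElem⟩⟩
  one_mul a := Subtype.ext (mem_iff.1 a.2).1
  mul_one a := Subtype.ext (mem_iff.1 a.2).2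

noncomputable instance : Algebra ℂ (cornerSubalgebra hp) :=
  Algebra.ofModule smul_mul_assoc mul_smul_comm

noncomputable instance : NormedAlgebra ℂ (cornerSubalgebra hp) where
  norm_smul_le := norm_smul_le

noncomputable instance : CStarAlgebra (cornerSubalgebra hp) where

@[simp]
theorem coe_one : ((1 : cornerSubalgebra hp) : A) = p := rfl

theorem nontrivial (h : p ≠ 0) : Nontrivial (cornerSubalgebra hp) :=
  ⟨1, 0, fun h' => h (congrArg Subtype.val h')⟩

theorem isMagicUnitary_of_coe {ι κ : Type*} [Fintype ι] [Fintype κ]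
    {w : Matrix ι κ (cornerSubalgebra hp)} (hw : ∀ i j, IsStarProjection (w i j : A))
    (hrow : ∀ i, ∑ j, (w i j : A) = p) (hcol : ∀ j, ∑ i, (w i j : A) = p) : IsMagicUnitary w where
  star_eq i j := Subtype.ext (hw i j).isSelfAdjoint
  mul_self i j := Subtype.ext (hw i j).isIdempotentElem
  sum_row i := Subtype.ext <| by simpa using hrow i
  sum_col j := Subtype.ext <| by simpa using hcol j

end cornerSubalgebra

/-! ### Block-diagonal matrices -/

section BlockDiagonal

variable {I : Type*} [DecidableEq I] {m n : I → Type*}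

theorem forall_blockDiagonal'_apply_iff {A : Type*} [Zero A] {M : ∀ i, Matrix (m i) (n i) A}
    {P : A → Prop} (h0 : P 0) :
    (∀ x y, P (Matrix.blockDiagonal' M x y)) ↔ ∀ i x y, P (M i x y) := by
  refine ⟨fun h i x y => by simpa using h ⟨i, x⟩ ⟨i, y⟩, ?_⟩
  rintro h ⟨i, x⟩ ⟨j, y⟩
  obtain rfl | hij := eq_or_ne i j
  · simpa using h i x y
  · rwa [Matrix.blockDiagonal'_apply_ne M x y hij]

theorem blockDiagonal'_blockDiag'_eq_self {A : Type*} [Zero A]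
    {w : Matrix (Σ i, m i) (Σ i, n i) A} (hw : ∀ x y, x.1 ≠ y.1 → w x y = 0) :
    Matrix.blockDiagonal' w.blockDiag' = w := by
  ext ⟨i, x⟩ ⟨j, y⟩
  obtain rfl | hij := eq_or_ne i j
  · simp only [Matrix.blockDiagonal'_apply_eq, Matrix.blockDiag'_apply]
  · rw [Matrix.blockDiagonal'_apply_ne _ x y hij, hw _ _ hij]

theorem sum_blockDiagonal'_row {A : Type*} [AddCommMonoid A] [Fintype I] [∀ i, Fintype (n i)]
    (M : ∀ i, Matrix (m i) (n i) A) (i : I) (x : m i) :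
    ∑ z, Matrix.blockDiagonal' M ⟨i, x⟩ z = ∑ y, M i x y := by
  rw [Fintype.sum_sigma, Fintype.sum_eq_single i]
  · simp only [Matrix.blockDiagonal'_apply_eq]
  · exact fun j hj => Finset.sum_eq_zero fun y _ => Matrix.blockDiagonal'_apply_ne M x y hj.symm

theorem sum_blockDiagonal'_col {A : Type*} [AddCommMonoid A] [Fintype I] [∀ i, Fintype (m i)]
    (M : ∀ i, Matrix (m i) (n i) A) (i : I) (y : n i) :
    ∑ z, Matrix.blockDiagonal' M z ⟨i, y⟩ = ∑ x, M i x y := by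
  simpa only [← Matrix.blockDiagonal'_transpose, Matrix.transpose_apply] using
    sum_blockDiagonal'_row (fun i => (M i).transpose) i y

end BlockDiagonal

/-! ### Magic unitaries -/

namespace IsMagicUnitary

variable {ι κ : Type*} [Fintype ι] [Fintype κ]

theorem transpose {A : Type*} [Ring A] [StarRing A] {w : Matrix ι κ A} (hw : IsMagicUnitary w) :
    IsMagicUnitary w.transpose where
  star_eq i j := hw.star_eq j i
  mul_self i j := hw.mul_self j i
  sum_row := hw.sum_col
  sum_col := hw.sum_row

theorem map {A B F : Type*} [Ring A] [StarRing A] [Ring B] [StarRing B] [FunLike F A B]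
    [RingHomClass F A B] [StarHomClass F A B] {w : Matrix ι κ A} (hw : IsMagicUnitary w) (φ : F) :
    IsMagicUnitary (w.map φ) where
  star_eq i j := by simp only [Matrix.map_apply, ← map_star, hw.star_eq]
  mul_self i j := by simp only [Matrix.map_apply, ← map_mul, hw.mul_self]
  sum_row i := by simp only [Matrix.map_apply, ← map_sum, hw.sum_row, map_one]
  sum_col j := by simp only [Matrix.map_apply, ← map_sum, hw.sum_col, map_one]

theorem isStarProjection {A : Type*} [Ring A] [StarRing A] {w : Matrix ι κ A}
    (hw : IsMagicUnitary w) (i : ι) (j : κ) : IsStarProjection (w i j) :=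
  ⟨hw.mul_self i j, hw.star_eq i j⟩

theorem blockDiagonal'_iff {I : Type*} [Fintype I] [DecidableEq I] {m n : I → Type*}
    [∀ i, Fintype (m i)] [∀ i, Fintype (n i)] {A : Type*} [Ring A] [StarRing A]
    {M : ∀ i, Matrix (m i) (n i) A} :
    IsMagicUnitary (Matrix.blockDiagonal' M) ↔ ∀ i, IsMagicUnitary (M i) where
  mp h i :=
    { star_eq := (forall_blockDiagonal'_apply_iff (P := fun a => star a = a) (star_zero A)).1
        h.star_eq i
      mul_self := (forall_blockDiagonal'_apply_iff (P := fun a => a * a = a) (mul_zero 0)).1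
        h.mul_self i
      sum_row := fun x => (sum_blockDiagonal'_row M i x).symm.trans (h.sum_row ⟨i, x⟩)
      sum_col := fun y => (sum_blockDiagonal'_col M i y).symm.trans (h.sum_col ⟨i, y⟩) }
  mpr h :=
    { star_eq := (forall_blockDiagonal'_apply_iff (P := fun a => star a = a) (star_zero A)).2
        fun i => (h i).star_eq
      mul_self := (forall_blockDiagonal'_apply_iff (P := fun a => a * a = a) (mul_zero 0)).2
        fun i => (h i).mul_self
      sum_row := fun ⟨i, x⟩ => (sum_blockDiagonal'_row M i x).trans ((h i).sum_row x)
      sum_col := fun ⟨i, y⟩ => (sum_blockDiagonal'_col M i y).trans ((h i).sum_col y) }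

variable {A : Type*} [CStarAlgebra A] {w : Matrix ι κ A}

theorem orthogonalIdempotents_row (hw : IsMagicUnitary w) (i : ι) :
    OrthogonalIdempotents (w i) where
  idem := hw.mul_self i
  ortho _ _ hjk :=
    mul_eq_zero_of_sum_eq_one (w i) (hw.star_eq i) (hw.mul_self i) (hw.sum_row i) hjk

theorem isStarProjection_sum_row (hw : IsMagicUnitary w) (i : ι) (s : Finset κ) :
    IsStarProjection (∑ j ∈ s, w i j) :=
  ⟨(hw.orthogonalIdempotents_row i).isIdempotentElem_sum,
    isSelfAdjoint_sum s fun j _ => hw.star_eq i j⟩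

theorem mem_cornerSubalgebra_sum_row (hw : IsMagicUnitary w) {i : ι} {s : Finset κ} {j : κ}
    (hj : j ∈ s) : w i j ∈ cornerSubalgebra (hw.isStarProjection_sum_row i s) := by
  have hmul : w i j * ∑ k ∈ s, w i k = w i j :=
    (hw.orthogonalIdempotents_row i).mul_sum_of_mem hj
  have hmul' := congrArg star hmul
  rw [star_mul, (hw.isStarProjection_sum_row i s).isSelfAdjoint.star_eq, hw.star_eq] at hmul'
  exact cornerSubalgebra.mem_iff.2 ⟨hmul', hmul⟩

end IsMagicUnitary

/-! ### Matrices respecting the adjacency relations of two graphs -/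

/-- The orthogonality relations of the quantum isomorphism game: entries of `w` whose row indices
and column indices are related differently in the two graphs have product zero. -/
def RespectsAdj {V W A : Type*} [Mul A] [Zero A] (G : SimpleGraph V) (H : SimpleGraph W)
    (w : Matrix V W A) : Prop :=
  ∀ ⦃x x' y y'⦄, ¬(G.Adj x x' ↔ H.Adj y y') → w x y * w x' y' = 0

namespace RespectsAdj

variable {V W A : Type*} {G : SimpleGraph V} {H : SimpleGraph W} {w : Matrix V W A}

theorem transpose [Mul A] [Zero A] (hw : RespectsAdj G H w) : RespectsAdj H G w.transpose :=
  fun _ _ _ _ h => hw fun h' => h h'.symm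

theorem submatrix [Mul A] [Zero A] {V' W' : Type*} {G' : SimpleGraph V'} {H' : SimpleGraph W'}
    (hw : RespectsAdj G H w) (f : G' ↪g G) (g : H' ↪g H) :
    RespectsAdj G' H' (w.submatrix f g) :=
  fun _ _ _ _ h => hw <| by rwa [f.map_adj_iff, g.map_adj_iff]

theorem map {B F : Type*} [Mul A] [Zero A] [Mul B] [Zero B] [FunLike F A B]
    [MulHomClass F A B] [ZeroHomClass F A B] (hw : RespectsAdj G H w) (φ : F) :
    RespectsAdj G H (w.map φ) :=
  fun _ _ _ _ h => by simp only [Matrix.map_apply, ← map_mul, hw h, map_zero]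

theorem adjMatrix_mul_eq_mul_adjMatrix [Fintype V] [Fintype W] [DecidableRel G.Adj]
    [DecidableRel H.Adj] [Semiring A] (hw : RespectsAdj G H w) (hrow : ∀ x, ∑ y, w x y = 1)
    (hcol : ∀ y, ∑ x, w x y = 1) : G.adjMatrix A * w = w * H.adjMatrix A := by
  have hswap : ∀ x x' y y', G.adjMatrix A x x' * (w x y' * w x' y) =
      w x y' * (w x' y * H.adjMatrix A y' y) := by
    intro x x' y y'
    by_cases h : G.Adj x x' ↔ H.Adj y' y
    · simp [SimpleGraph.adjMatrix_apply, h]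
    · rw [← mul_assoc (w x y'), hw h, mul_zero, zero_mul]
  ext x y
  simp only [Matrix.mul_apply]
  calc ∑ x', G.adjMatrix A x x' * w x' y
      = ∑ x', ∑ y', G.adjMatrix A x x' * (w x y' * w x' y) := by
        simp only [← Finset.mul_sum, ← Finset.sum_mul, hrow, one_mul]
    _ = ∑ y', ∑ x', w x y' * (w x' y * H.adjMatrix A y' y) := by
        rw [Finset.sum_comm]; simp only [hswap]
    _ = ∑ y', w x y' * H.adjMatrix A y' y := by
        simp only [← Finset.mul_sum, ← Finset.sum_mul, hcol, one_mul]

theorem sum_row_eq_of_adj [Fintype W] [NonAssocSemiring A] (hw : RespectsAdj G H w)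
    (hrow : ∀ x, ∑ y, w x y = 1) {s : Finset W} (hs : ∀ y ∈ s, ∀ y', H.Adj y y' → y' ∈ s)
    {x x' : V} (h : G.Adj x x') : ∑ y ∈ s, w x y = ∑ y ∈ s, w x' y := by
  classical
  have hadd : ∀ z, ∑ y ∈ s, w z y + ∑ y ∈ sᶜ, w z y = 1 := fun z =>
    (Finset.sum_add_sum_compl s (w z)).trans (hrow z)
  have hright : (∑ y ∈ s, w x y) * ∑ y ∈ sᶜ, w x' y = 0 := by
    rw [Finset.sum_mul_sum]
    refine Finset.sum_eq_zero fun y hy => Finset.sum_eq_zero fun y' hy' => hw fun hiff => ?_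
    exact Finset.mem_compl.1 hy' (hs y hy y' (hiff.1 h))
  have hleft : (∑ y ∈ sᶜ, w x y) * ∑ y ∈ s, w x' y = 0 := by
    rw [Finset.sum_mul_sum]
    refine Finset.sum_eq_zero fun y hy => Finset.sum_eq_zero fun y' hy' => hw fun hiff => ?_
    exact Finset.mem_compl.1 hy (hs y' hy' y (hiff.1 h).symm)
  calc ∑ y ∈ s, w x y
      = (∑ y ∈ s, w x y) * (∑ y ∈ s, w x' y + ∑ y ∈ sᶜ, w x' y) := by rw [hadd, mul_one]
    _ = (∑ y ∈ s, w x y + ∑ y ∈ sᶜ, w x y) * ∑ y ∈ s, w x' y := by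
        rw [mul_add, add_mul, hright, hleft]
    _ = ∑ y ∈ s, w x' y := by rw [hadd, one_mul]

theorem sum_row_eq_of_reachable [Fintype W] [NonAssocSemiring A] (hw : RespectsAdj G H w)
    (hrow : ∀ x, ∑ y, w x y = 1) {s : Finset W} (hs : ∀ y ∈ s, ∀ y', H.Adj y y' → y' ∈ s)
    {x x' : V} (h : G.Reachable x x') : ∑ y ∈ s, w x y = ∑ y ∈ s, w x' y := by
  obtain ⟨p⟩ := h
  induction p with
  | nil => rfl
  | cons hadj _ ih => exact (hw.sum_row_eq_of_adj hrow hs hadj).trans ih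

end RespectsAdj

/-! ### Quantum isomorphisms -/

namespace ColoredGraph

/-- A quantum isomorphism between two colored graphs over a *-algebra `A`: a magic unitary
satisfying the adjacency and color relations of the quantum isomorphism game. Quantum
automorphisms are the matrices satisfying the relations of `Qut_c`. -/
structure IsQuantumIsomorphism {V W C A : Type*} [Fintype V] [Fintype W] [Ring A] [StarRing A]
    (X : ColoredGraph V C) (Y : ColoredGraph W C) (w : Matrix V W A) : Prop where
  magic : IsMagicUnitary w
  respectsAdj : RespectsAdj X.graph Y.graph w
  color : ∀ x y, X.color x ≠ Y.color y → w x y = 0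

theorem isQutMatrix_iff {V : Type u} {C A : Type*} [Fintype V] [CStarAlgebra A]
    {X : ColoredGraph V C} {w : Matrix V V A} :
    X.IsQutMatrix w ↔ IsQuantumIsomorphism X X w where
  mp h :=
    { magic := h.magic
      respectsAdj := fun x x' y y' hadj => by
        by_cases hx : X.graph.Adj x x'
        · exact h.adj_left x y x' y' hx fun hy => hadj (iff_of_true hx hy)
        · exact h.adj_right x y x' y' hx <| by_contra fun hy => hadj (iff_of_false hx hy)
      color := h.color }
  mpr h :=
    { magic := h.magic
      adj_left := fun _ _ _ _ hx hy => h.respectsAdj fun hadj => hy (hadj.1 hx)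
      adj_right := fun _ _ _ _ hx hy => h.respectsAdj fun hadj => hx (hadj.2 hy)
      color := h.color }

/-- An isomorphism of the colored graph `X'` onto a connected component of `X`. Allowing an
arbitrary `X'` makes a component of a member of a family and its image in the disjoint union of
the family interchangeable. -/
structure ComponentEmbedding {V V' C : Type*} (X' : ColoredGraph V' C) (X : ColoredGraph V C)
    extends X'.graph ↪g X.graph where
  preconnected : X'.graph.Preconnected
  color_apply : ∀ y, X.color (toFun y) = X'.color y
  mem_range_of_adj : ∀ y x, X.graph.Adj (toFun y) x → x ∈ Set.range toFun

namespace ComponentEmbedding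

variable {V V' C : Type*} {X' : ColoredGraph V' C} {X : ColoredGraph V C}

instance : CoeFun (ComponentEmbedding X' X) fun _ => V' → V := ⟨fun F => F.toFun⟩

/-- The vertex set of the component onto which `F` maps. -/
def vertexSet [Fintype V'] (F : ComponentEmbedding X' X) : Finset V := Finset.univ.map F.toEmbedding

theorem mem_vertexSet [Fintype V'] (F : ComponentEmbedding X' X) (y : V') : F y ∈ F.vertexSet :=
  Finset.mem_map_of_mem F.toEmbedding (Finset.mem_univ y)

theorem mem_vertexSet_of_adj [Fintype V'] (F : ComponentEmbedding X' X) {x x' : V}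
    (hx : x ∈ F.vertexSet) (h : X.graph.Adj x x') : x' ∈ F.vertexSet := by
  obtain ⟨y, -, rfl⟩ := Finset.mem_map.1 hx
  obtain ⟨y', rfl⟩ := F.mem_range_of_adj y x' h
  exact F.mem_vertexSet y'

theorem sum_vertexSet [Fintype V'] {M : Type*} [AddCommMonoid M] (F : ComponentEmbedding X' X)
    (f : V → M) : ∑ x ∈ F.vertexSet, f x = ∑ y, f (F y) :=
  Finset.sum_map _ _ _

theorem reachable (F : ComponentEmbedding X' X) (y y' : V') : X.graph.Reachable (F y) (F y') :=
  (F.preconnected y y').map F.toRelEmbedding.toRelHom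

end ComponentEmbedding

namespace IsQuantumIsomorphism

variable {V W C : Type*} [Fintype V] [Fintype W] {X : ColoredGraph V C} {Y : ColoredGraph W C}

theorem transpose {A : Type*} [Ring A] [StarRing A] {w : Matrix V W A}
    (hw : IsQuantumIsomorphism X Y w) : IsQuantumIsomorphism Y X w.transpose where
  magic := hw.magic.transpose
  respectsAdj := hw.respectsAdj.transpose
  color y x h := hw.color x y h.symm

theorem map {A B F : Type*} [Ring A] [StarRing A] [Ring B] [StarRing B] [FunLike F A B]
    [RingHomClass F A B] [StarHomClass F A B] {w : Matrix V W A}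
    (hw : IsQuantumIsomorphism X Y w) (φ : F) : IsQuantumIsomorphism X Y (w.map φ) where
  magic := hw.magic.map φ
  respectsAdj := hw.respectsAdj.map φ
  color x y h := by rw [Matrix.map_apply, hw.color x y h, map_zero]

theorem quantumIsomorphic {V W : Type u} [Fintype V] [Fintype W] {X : ColoredGraph V C}
    {Y : ColoredGraph W C} {A : Type u} [CStarAlgebra A] [Nontrivial A] {w : Matrix V W A}
    (hw : IsQuantumIsomorphism X Y w) : X.QuantumIsomorphic Y := by
  classical
  exact ⟨A, inferInstance, inferInstance, w, hw.magic,
    hw.respectsAdj.adjMatrix_mul_eq_mul_adjMatrix hw.magic.sum_row hw.magic.sum_col, hw.color⟩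

section Component

variable {V' W' : Type*} [Fintype W'] {X' : ColoredGraph V' C}
  {Y' : ColoredGraph W' C} {A : Type*} [CStarAlgebra A] {w : Matrix V W A}

theorem sum_row_component_eq (hw : IsQuantumIsomorphism X Y w) (F : ComponentEmbedding X' X)
    (G : ComponentEmbedding Y' Y) (x x' : V') :
    ∑ y ∈ G.vertexSet, w (F x) y = ∑ y ∈ G.vertexSet, w (F x') y :=
  hw.respectsAdj.sum_row_eq_of_reachable hw.magic.sum_row
    (fun _ hy _ h => G.mem_vertexSet_of_adj hy h) (F.reachable x x')

theorem sum_col_component_eq_sum_row [Fintype V'] (hw : IsQuantumIsomorphism X Y w)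
    (F : ComponentEmbedding X' X) (G : ComponentEmbedding Y' Y) (x : V') (y : W') :
    ∑ x' ∈ F.vertexSet, w x' (G y) = ∑ y' ∈ G.vertexSet, w (F x) y' := by
  have : Nonempty V' := ⟨x⟩
  have : Nonempty W' := ⟨y⟩
  have : IsAddTorsionFree A := .of_isTorsionFree ℂ A
  refine (eq_of_sum_row_eq_of_sum_col_eq (M := w.submatrix F G)
    (hw.magic.isStarProjection_sum_row (F x) G.vertexSet).isIdempotentElem
    (hw.transpose.magic.isStarProjection_sum_row (G y) F.vertexSet).isIdempotentElem
    (fun x' => ?_) fun y' => ?_).symm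
  · exact (G.sum_vertexSet _).symm.trans (hw.sum_row_component_eq F G x' x)
  · exact (F.sum_vertexSet _).symm.trans (hw.transpose.sum_row_component_eq G F y' y)

/-- The block of a quantum isomorphism given by two components, as a matrix over the corner at the
common value of the row and column sums of that block. -/
def componentBlock (hw : IsQuantumIsomorphism X Y w) (F : ComponentEmbedding X' X)
    (G : ComponentEmbedding Y' Y) (x₀ : V') :
    Matrix V' W' (cornerSubalgebra (hw.magic.isStarProjection_sum_row (F x₀) G.vertexSet)) :=
  Matrix.of fun x y => ⟨w (F x) (G y), by
    simpa only [hw.sum_row_component_eq F G x₀ x] using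
      hw.magic.mem_cornerSubalgebra_sum_row (G.mem_vertexSet y)⟩

theorem componentBlock_isQuantumIsomorphism [Fintype V'] (hw : IsQuantumIsomorphism X Y w)
    (F : ComponentEmbedding X' X) (G : ComponentEmbedding Y' Y) (x₀ : V') :
    IsQuantumIsomorphism X' Y' (hw.componentBlock F G x₀) where
  magic := cornerSubalgebra.isMagicUnitary_of_coe
    (fun x y => hw.magic.isStarProjection (F x) (G y))
    (fun x => (G.sum_vertexSet _).symm.trans (hw.sum_row_component_eq F G x x₀))
    (fun y => (F.sum_vertexSet _).symm.trans (hw.sum_col_component_eq_sum_row F G x₀ y))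
  respectsAdj x x' y y' h := Subtype.ext <|
    hw.respectsAdj.submatrix F.toRelEmbedding G.toRelEmbedding h
  color x y h := Subtype.ext <| hw.color _ _ <| by rwa [F.color_apply, G.color_apply]

end Component

theorem quantumIsomorphic_of_apply_ne_zero {V' W' : Type u} [Fintype V'] [Fintype W']
    {X' : ColoredGraph V' C} {Y' : ColoredGraph W' C} {A : Type u} [CStarAlgebra A]
    {w : Matrix V W A} (hw : IsQuantumIsomorphism X Y w) (F : ComponentEmbedding X' X)
    (G : ComponentEmbedding Y' Y) {x : V'} {y : W'} (h : w (F x) (G y) ≠ 0) :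
    X'.QuantumIsomorphic Y' := by
  have hp : ∑ y ∈ G.vertexSet, w (F x) y ≠ 0 := fun h0 => h <| by
    rw [← (hw.magic.orthogonalIdempotents_row (F x)).mul_sum_of_mem (G.mem_vertexSet y), h0,
      mul_zero]
  have := cornerSubalgebra.nontrivial (hp := hw.magic.isStarProjection_sum_row _ _) hp
  exact (hw.componentBlock_isQuantumIsomorphism F G x).quantumIsomorphic

end IsQuantumIsomorphism

end ColoredGraph

/-! ### Disjoint unions -/

namespace ColoredGraph

section DisjointUnion

variable {I C : Type*} {V : I → Type*} {X : ∀ i, ColoredGraph (V i) C}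

theorem disjointUnion_adj_mk_iff {i : I} {a b : V i} :
    (disjointUnion X).graph.Adj ⟨i, a⟩ ⟨i, b⟩ ↔ (X i).graph.Adj a b := by
  refine ⟨?_, fun h => ⟨i, a, b, h, rfl, rfl⟩⟩
  rintro ⟨_, _, _, h, ⟨⟩, ⟨⟩⟩
  exact h

theorem fst_eq_of_disjointUnion_adj {x y : Σ i, V i} (h : (disjointUnion X).graph.Adj x y) :
    x.1 = y.1 := by
  obtain ⟨i, a, b, -, rfl, rfl⟩ := h
  rfl

variable (X) in
/-- A connected component of a member of a family of graphs, as a component of the disjoint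
union. -/
def componentEmbedding (i : I) (K : (X i).graph.ConnectedComponent) :
    ComponentEmbedding ((X i).component K) (disjointUnion X) where
  toFun x := ⟨i, x⟩
  inj' := sigma_mk_injective.comp Subtype.val_injective
  map_rel_iff' := disjointUnion_adj_mk_iff
  preconnected := K.connected_toSimpleGraph.preconnected
  color_apply _ := rfl
  mem_range_of_adj := by
    rintro x ⟨j, y⟩ h
    obtain rfl : i = j := fst_eq_of_disjointUnion_adj h
    exact ⟨⟨y, K.mem_supp_of_adj_mem_supp x.2 (disjointUnion_adj_mk_iff.1 h)⟩, rfl⟩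

end DisjointUnion

section Blocks

variable {I C : Type*} {V W : I → Type*} {X : ∀ i, ColoredGraph (V i) C}
  {Y : ∀ i, ColoredGraph (W i) C}

theorem respectsAdj_blockDiagonal'_iff [DecidableEq I] {A : Type*} [MulZeroClass A]
    {M : ∀ i, Matrix (V i) (W i) A} :
    RespectsAdj (disjointUnion X).graph (disjointUnion Y).graph (Matrix.blockDiagonal' M) ↔
      ∀ i, RespectsAdj (X i).graph (Y i).graph (M i) := by
  refine ⟨fun h i x x' y y' hadj => ?_, ?_⟩
  · simpa only [Matrix.blockDiagonal'_apply_eq] using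
      @h ⟨i, x⟩ ⟨i, x'⟩ ⟨i, y⟩ ⟨i, y'⟩ (by simpa only [disjointUnion_adj_mk_iff] using hadj)
  · rintro h ⟨i, x⟩ ⟨i', x'⟩ ⟨j, y⟩ ⟨j', y'⟩ hadj
    obtain rfl | hij := eq_or_ne i j
    swap
    · rw [Matrix.blockDiagonal'_apply_ne M x y hij, zero_mul]
    obtain rfl | hij' := eq_or_ne i' j'
    swap
    · rw [Matrix.blockDiagonal'_apply_ne M x' y' hij', mul_zero]
    obtain rfl : i = i' := by
      by_contra hne
      exact hadj (iff_of_false (fun h => hne (fst_eq_of_disjointUnion_adj h))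
        fun h => hne (fst_eq_of_disjointUnion_adj h))
    simp only [Matrix.blockDiagonal'_apply_eq]
    exact h i (by simpa only [disjointUnion_adj_mk_iff] using hadj)

variable [Fintype I] [∀ i, Fintype (V i)]

theorem isQuantumIsomorphism_blockDiagonal'_iff [DecidableEq I] [∀ i, Fintype (W i)] {A : Type*}
    [Ring A] [StarRing A] {M : ∀ i, Matrix (V i) (W i) A} :
    IsQuantumIsomorphism (disjointUnion X) (disjointUnion Y) (Matrix.blockDiagonal' M) ↔
      ∀ i, IsQuantumIsomorphism (X i) (Y i) (M i) where
  mp h i :=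
    { magic := IsMagicUnitary.blockDiagonal'_iff.1 h.magic i
      respectsAdj := respectsAdj_blockDiagonal'_iff.1 h.respectsAdj i
      color := fun x y hc => by
        simpa only [Matrix.blockDiagonal'_apply_eq] using h.color ⟨i, x⟩ ⟨i, y⟩ hc }
  mpr h :=
    { magic := IsMagicUnitary.blockDiagonal'_iff.2 fun i => (h i).magic
      respectsAdj := respectsAdj_blockDiagonal'_iff.2 fun i => (h i).respectsAdj
      color := by
        rintro ⟨i, x⟩ ⟨j, y⟩ hc
        obtain rfl | hij := eq_or_ne i j
        · simpa only [Matrix.blockDiagonal'_apply_eq] using (h i).color x y hc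
        · exact Matrix.blockDiagonal'_apply_ne M x y hij }

theorem IsQuantumIsomorphism.apply_eq_zero_of_fst_ne {V W : I → Type u} [∀ i, Fintype (V i)]
    [∀ i, Fintype (W i)] {X : ∀ i, ColoredGraph (V i) C} {Y : ∀ i, ColoredGraph (W i) C}
    (hXY : ∀ i j, i ≠ j → ∀ (K : (X i).graph.ConnectedComponent)
      (L : (Y j).graph.ConnectedComponent),
      ¬ ((X i).component K).QuantumIsomorphic ((Y j).component L))
    {A : Type u} [CStarAlgebra A] {w : Matrix (Σ i, V i) (Σ i, W i) A}
    (hw : IsQuantumIsomorphism (disjointUnion X) (disjointUnion Y) w) {x : Σ i, V i}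
    {y : Σ i, W i} (hxy : x.1 ≠ y.1) : w x y = 0 := by
  obtain ⟨i, x⟩ := x
  obtain ⟨j, y⟩ := y
  by_contra h
  let K := (X i).graph.connectedComponentMk x
  let L := (Y j).graph.connectedComponentMk y
  refine hXY i j hxy K L <| hw.quantumIsomorphic_of_apply_ne_zero (componentEmbedding X i K)
    (componentEmbedding Y j L) (x := ⟨x, ?_⟩) (y := ⟨y, ?_⟩) h
  all_goals exact SimpleGraph.ConnectedComponent.connectedComponentMk_mem

end Blocks

theorem qutFund_map_qutLift {V : Type u} {C A : Type*} [Fintype V] [CStarAlgebra A]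
    (X : ColoredGraph V C) {w : Matrix V V A} (hw : X.IsQutMatrix w) :
    X.qutFund.map (X.qutLift w hw) = w :=
  Matrix.ext fun i j => X.qutLift_fund w hw i j

end ColoredGraph

/-! ### Morphisms of compact matrix quantum groups -/

namespace CompactMatrixQuantumGroup

section Same

variable {ι : Type u} [Fintype ι] [DecidableEq ι]

open scoped CStarAlgebra in
theorem starAlgHom_ext (G : CompactMatrixQuantumGroup ι) {B : Type*} [CStarAlgebra B]
    {φ ψ : G.Carrier →⋆ₐ[ℂ] B} (h : G.fund.map φ = G.fund.map ψ) : φ = ψ := by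
  have hgen : StarAlgebra.adjoin ℂ (Set.range fun ij : ι × ι => G.fund ij.1 ij.2) ≤
      StarAlgHom.equalizer φ ψ := by
    refine StarAlgebra.adjoin_le_iff.2 ?_
    rintro _ ⟨⟨i, j⟩, rfl⟩
    exact congrFun₂ h i j
  have hclosure := StarSubalgebra.topologicalClosure_minimal hgen
    (isClosed_eq (map_continuous φ) (map_continuous ψ))
  rw [G.generates] at hclosure
  exact StarAlgHom.ext fun a => hclosure StarSubalgebra.mem_top

theorem same_of_starAlgHom {G H : CompactMatrixQuantumGroup ι} (φ : G.Carrier →⋆ₐ[ℂ] H.Carrier)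
    (ψ : H.Carrier →⋆ₐ[ℂ] G.Carrier) (hφ : G.fund.map φ = H.fund) (hψ : H.fund.map ψ = G.fund) :
    Same G H := by
  have hφ' : ∀ i j, φ (G.fund i j) = H.fund i j := congrFun₂ hφ
  have hleft : ψ.comp φ = StarAlgHom.id ℂ _ := G.starAlgHom_ext <| by
    rw [StarAlgHom.coe_comp, ← Matrix.map_map, hφ, hψ]
    exact G.fund.map_id.symm
  have hright : φ.comp ψ = StarAlgHom.id ℂ _ := H.starAlgHom_ext <| by
    rw [StarAlgHom.coe_comp, ← Matrix.map_map, hψ, hφ]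
    exact H.fund.map_id.symm
  have hcomul : H.comul.comp φ = (MinTensor.map φ φ).comp G.comul :=
    G.starAlgHom_ext <| Matrix.ext fun i j => by
      simp only [Matrix.map_apply, StarAlgHom.comp_apply, hφ', comul_fund, map_sum,
        MinTensor.map_tmul]
  exact ⟨StarAlgEquiv.ofStarAlgHom φ ψ hleft hright, hφ', DFunLike.congr_fun hcomul⟩

end Same

theorem freeProductFund_map_lift {I : Type} [DecidableEq I] {ι : I → Type u} [∀ i, Fintype (ι i)]
    [∀ i, DecidableEq (ι i)] (G : ∀ i, CompactMatrixQuantumGroup (ι i)) {B : Type*}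
    [CStarAlgebra B] (f : ∀ i, (G i).Carrier →⋆ₐ[ℂ] B) :
    (freeProductFund G).map (FreeProductCStar.lift f) =
      Matrix.blockDiagonal' fun i => (G i).fund.map (f i) := by
  rw [freeProductFund, Matrix.blockDiagonal'_map _ _ (map_zero _)]
  exact congrArg _ <| funext fun i => Matrix.ext fun x y => FreeProductCStar.lift_incl f i _

end CompactMatrixQuantumGroup

theorem mainTheorem4_general {I : Type} [Fintype I] [DecidableEq I] {C : Type*} {V : I → Type u}
    [∀ i, Fintype (V i)] [∀ i, DecidableEq (V i)] (X : ∀ i, ColoredGraph (V i) C)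
    (hX : ∀ i j, i ≠ j → ∀ (K : (X i).graph.ConnectedComponent)
      (L : (X j).graph.ConnectedComponent),
      ¬ ((X i).component K).QuantumIsomorphic ((X j).component L)) :
    CompactMatrixQuantumGroup.Same (ColoredGraph.disjointUnion X).qut
      (CompactMatrixQuantumGroup.freeProduct fun i => (X i).qut) := by
  let u := (ColoredGraph.disjointUnion X).qutFund
  let v := CompactMatrixQuantumGroup.freeProductFund fun i => (X i).qut
  have hu := ColoredGraph.isQutMatrix_iff.1 (ColoredGraph.disjointUnion X).isQutMatrix_qutFund
  have hblock : Matrix.blockDiagonal' u.blockDiag' = u :=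
    blockDiagonal'_blockDiag'_eq_self fun x y => hu.apply_eq_zero_of_fst_ne hX
  have hu' : ∀ i, (X i).IsQutMatrix (u.blockDiag' i) := fun i => ColoredGraph.isQutMatrix_iff.2 <|
    ColoredGraph.isQuantumIsomorphism_blockDiagonal'_iff.1 (hblock.symm ▸ hu) i
  have hv : (ColoredGraph.disjointUnion X).IsQutMatrix v := ColoredGraph.isQutMatrix_iff.2 <|
    ColoredGraph.isQuantumIsomorphism_blockDiagonal'_iff.2 fun i =>
      (ColoredGraph.isQutMatrix_iff.1 (X i).isQutMatrix_qutFund).map _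
  have hlift : v.map (FreeProductCStar.lift fun i => (X i).qutLift _ (hu' i)) = u :=
    calc _ = Matrix.blockDiagonal' fun i => (X i).qutFund.map ((X i).qutLift _ (hu' i)) :=
          CompactMatrixQuantumGroup.freeProductFund_map_lift (fun i => (X i).qut) _
      _ = Matrix.blockDiagonal' u.blockDiag' :=
          congrArg _ <| funext fun i => (X i).qutFund_map_qutLift (hu' i)
      _ = u := hblock
  exact CompactMatrixQuantumGroup.same_of_starAlgHom _ _
    (ColoredGraph.qutFund_map_qutLift _ hv) hlift

theorem mainTheorem4 {n : ℕ} {C : Type*} {V : Fin n → Type u} [∀ i, Fintype (V i)]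
    [∀ i, DecidableEq (V i)] (X : ∀ i, ColoredGraph (V i) C)
    (hX : ∀ i j, i ≠ j → ∀ (K : (X i).graph.ConnectedComponent)
      (L : (X j).graph.ConnectedComponent),
      ¬ ((X i).component K).QuantumIsomorphic ((X j).component L)) :
    CompactMatrixQuantumGroup.Same (ColoredGraph.disjointUnion X).qut
      (CompactMatrixQuantumGroup.freeProduct fun i => (X i).qut) :=
  mainTheorem4_general X hX
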